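/- Let $(X,d)$ be a nonempty compact metric space and let $T$ be a correspondence on $X$, i.e. an upper semicontinuous map from $X$ to the nonempty closed subsets of $X$ (for every $x$ and every open $U\supset T(x)$ there is a neighbourhood $V$ of $x$ with $T(y)\subset U$ for all $y\in V$); no expansiveness is assumed. For $n\ge 1$ put $\mathcal O_{n}(T)=\{(x_1,\dots,x_{n})\in X^{n}: x_{i+1}\in T(x_i),\ 1\le i<n\}$ with the maximum metric. For a continuous $\phi:\mathcal O_2(T)\to\mathbb R$ let $S_n\phi(x_1,\dots,x_{n+1})=\sum_{i=1}^n\phi(x_i,x_{i+1})$ and define the topological pressure $$P(T,\phi)=\lim_{\epsilon\to0^+}\limsup_{n\to\infty}\frac1n\log\sup_{E}\sum_{x\in E}e^{S_n\phi(x)}\in(-\infty,+\infty],$$ where $E$ ranges over the $\epsilon$-separated subsets of $\mathcal O_{n+1}(T)$ (distinct points are at distance $\ge\epsilon$). Let $h_{\mathrm{top}}(T)=P(T,0)$. A transition probability kernel $\mathcal Q$ on $X$ (with its Borel $\sigma$-algebra) is supported by $T$ if $\mathcal Q_x(T(x))=1$ for every $x\in X$; a Borel probability measure $\mu$ is $\mathcal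 Q$-invariant if $\mu\mathcal Q=\mu$, where $(\mu\mathcal Q)(A)=\int\mathcal Q_x(A)\,d\mu(x)$. Write $\iint\phi\,d\mathcal Q\,d\mu=\int_X\int_{T(x_1)}\phi(x_1,x_2)\,d\mathcal Q_{x_1}(x_2)\,d\mu(x_1)$. For $\mathcal Q$ supported by $T$ and a Borel probability measure $\mu$, the abstract measure-theoretic entropy is $$\mathfrak h_\mu(\mathcal Q)=\inf\Big\{\iint\phi\,d\mathcal Q\,d\mu:\ \phi\in C(\mathcal O_2(T)),\ P(T,-\phi)\le0\Big\}\in[-\infty,+\infty],\qquad \inf\emptyset=+\infty.$$ For a $\mathcal Q$-invariant $\mu$, the measure-theoretic entropy is $$h_\mu(\mathcal Q)=\sup_{\mathcal A}\lim_{n\to\infty}\frac1n H_{\mu\mathcal Q^{[n-1]}}(\mathcal A^n),$$ where $\mathcal A$ ranges over the finite measurable partitions of $X$, $\mathcal A^n$ is the product partition of $X^n$, $\mu\mathcal Q^{[n-1]}$ is the law of the first $n$ positions of the Markov chain with initial law $\mu$ and transition kernel $\mathcal Q$, and $H_\nu(\mathcal B)=-\sum_{B\in\mathcal B}\nu(B)\log\nu(B)$.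 Then the following hold. (i) For every continuous $\phi:\mathcal O_2(T)\to\mathbb R$, $$P(T,\phi)=\max_{\mathcal Q,\mu}\Big\{\mathfrak h_\mu(\mathcal Q)+\iint\phi\,d\mathcal Q\,d\mu\Big\},$$ where $\mathcal Q$ ranges over all transition probability kernels on $X$ supported by $T$ and $\mu$ ranges over all Borel probability measures on $X$; the same equality holds, with the maximum attained, when $\mu$ ranges only over the $\mathcal Q$-invariant Borel probability measures. (ii) If $h_{\mathrm{top}}(T)<+\infty$, then for every continuous $\phi:\mathcal O_2(T)\to\mathbb R$, every pair $(\mathcal Q,\mu)$ that attains the maximum in (i) satisfies $\mu\mathcal Q=\mu$. (iii) For every transition probability kernel $\mathcal Q$ on $X$ supported by $T$ and every Borel probability measure $\mu$ on $X$, $$\mathfrak h_\mu(\mathcal Q)=\inf_{\phi\in C(\mathcal O_2(T))}\Big\{P(T,\phi)-\iint\phi\,d\mathcal Q\,d\mu\Big\}.$$ (iv) For every transition probability kernel $\mathcal Q$ on $X$ supported by $T$ and every $\mathcal Q$-invariant Borel probability measure $\mu$ on $X$, $0\le h_\mu(\mathcal Q)\le\mathfrak h_\mu(\mathcal Q)$.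 -/

import Mathlib

open MeasureTheory ProbabilityTheory Filter Topology
open scoped ENNReal

/-- A correspondence on `X`: an upper semicontinuous map from `X` to the nonempty closed
subsets of `X`.  Upper semicontinuity at `x` says that every neighbourhood of the set `T x`
contains `T y` for all `y` close to `x`. -/
structure Correspondence (X : Type*) [TopologicalSpace X] where
  /-- The underlying set-valued map. -/
  toFun : X → Set X
  nonempty' : ∀ x, (toFun x).Nonempty
  isClosed' : ∀ x, IsClosed (toFun x)
  upperHemicontinuous' : UpperHemicontinuous toFun

namespace Correspondence

section Pressure

variable {X : Type*} [MetricSpace X]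

/-- The space `O₂(T)`, i.e. the graph of `T`. -/
def graph (T : Correspondence X) : Set (X × X) := {p | p.2 ∈ T.toFun p.1}

/-- The space `O_{n+1}(T)` of orbits `(x₀, …, xₙ)` of length `n + 1`.  As a subset of
`Fin (n + 1) → X` it carries the maximum metric. -/
def orbits (T : Correspondence X) (n : ℕ) : Set (Fin (n + 1) → X) :=
  {x | ∀ i : Fin n, x i.succ ∈ T.toFun (x i.castSucc)}

/-- The Birkhoff sum `Sₙφ(x₀, …, xₙ) = φ(x₀, x₁) + ⋯ + φ(xₙ₋₁, xₙ)`. -/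
noncomputable def birkhoff (T : Correspondence X) (φ : C(T.graph, ℝ)) (n : ℕ)
    (x : T.orbits n) : ℝ :=
  ∑ i : Fin n, φ ⟨(x.1 i.castSucc, x.1 i.succ), x.2 i⟩

/-- `sₙ(T, φ, ε)`: the supremum of `∑_{x ∈ E} exp (Sₙφ x)` over the `ε`-separated subsets `E`
of `O_{n+1}(T)`.  (In a compact space all `ε`-separated sets are finite.) -/
noncomputable def separatedSum (T : Correspondence X) (φ : C(T.graph, ℝ)) (ε : ℝ) (n : ℕ) :
    ℝ≥0∞ :=
  ⨆ (E : Finset (T.orbits n)) (_ : (E : Set (T.orbits n)).Pairwise fun x y => ε ≤ dist x y),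
    ∑ x ∈ E, ENNReal.ofReal (Real.exp (T.birkhoff φ n x))

/-- The pressure at scale `ε`: `limsup_{n → ∞} (1/n) log sₙ(T, φ, ε)`. -/
noncomputable def pressureAt (T : Correspondence X) (φ : C(T.graph, ℝ)) (ε : ℝ) : EReal :=
  limsup (fun n : ℕ => ENNReal.log (T.separatedSum φ ε n) / (n : EReal)) atTop

/-- The topological pressure `P(T, φ)`, the limit as `ε → 0⁺` of the pressure at scale `ε`.
It is written as a supremum because the pressure at scale `ε` is monotone in `ε`;
see `tendsto_pressureAt`. -/
noncomputable def pressure (T : Correspondence X) (φ : C(T.graph, ℝ)) : EReal :=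
  ⨆ (ε : ℝ) (_ : 0 < ε), T.pressureAt φ ε

/-- The topological entropy of `T`. -/
noncomputable def topEntropy (T : Correspondence X) : EReal := T.pressure 0

theorem pressureAt_antitone (T : Correspondence X) (φ : C(T.graph, ℝ)) :
    Antitone (T.pressureAt φ) := by
  intro ε δ h
  refine limsup_le_limsup (Eventually.of_forall fun n => ?_)
  refine EReal.div_le_div_right_of_nonneg (by positivity) (ENNReal.log_monotone ?_)
  exact iSup_mono fun E => iSup_le fun hE =>
    le_iSup (fun _ : (E : Set (T.orbits n)).Pairwise fun x y => ε ≤ dist x y =>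
      ∑ x ∈ E, ENNReal.ofReal (Real.exp (T.birkhoff φ n x)))
      (fun x hx y hy hxy => h.trans (hE hx hy hxy))

/-- The pressure is the limit, as `ε → 0⁺`, of the pressure at scale `ε`. -/
theorem tendsto_pressureAt (T : Correspondence X) (φ : C(T.graph, ℝ)) :
    Tendsto (T.pressureAt φ) (𝓝[>] 0) (𝓝 (T.pressure φ)) := by
  refine tendsto_order.2 ⟨fun a ha => ?_, fun a ha => ?_⟩
  · obtain ⟨ε, hε⟩ := lt_iSup_iff.1 ha
    obtain ⟨h0, hε⟩ := lt_iSup_iff.1 hε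
    filter_upwards [Ioc_mem_nhdsGT h0] with δ hδ
    exact hε.trans_le (T.pressureAt_antitone φ hδ.2)
  · filter_upwards [self_mem_nhdsWithin] with δ hδ
    exact (le_iSup₂ (f := fun (ε : ℝ) (_ : 0 < ε) => T.pressureAt φ ε) δ hδ).trans_lt ha

end Pressure

section Entropy

variable {X : Type*} [MetricSpace X] [MeasurableSpace X]

/-- The kernel `Q` is supported by `T`: `Q_x(T(x)) = 1` for every `x`. -/
def Supports (T : Correspondence X) (Q : Kernel X X) : Prop :=
  ∀ x, Q x (T.toFun x) = 1

/-- The double integral `∫_X ∫_{T(x₁)} φ(x₁, x₂) dQ_{x₁}(x₂) dμ(x₁)`.  The function `φ`, which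
lives on the graph of `T`, is extended by zero to `X × X`; the inner integral only sees its
values on the graph. -/
noncomputable def doubleIntegral (T : Correspondence X) (Q : Kernel X X) (μ : Measure X)
    (φ : C(T.graph, ℝ)) : ℝ :=
  ∫ x, ∫ y in T.toFun x, Function.extend Subtype.val φ 0 (x, y) ∂(Q x) ∂μ

/-- The abstract measure-theoretic entropy `𝔥_μ(Q)`: the infimum in `[-∞, ∞]` of `∬ φ dQ dμ`
over the continuous `φ` on the graph of `T` with `P(T, -φ) ≤ 0`. -/
noncomputable def abstractEntropy (T : Correspondence X) (Q : Kernel X X) (μ : Measure X) :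
    EReal :=
  ⨅ (φ : C(T.graph, ℝ)) (_ : T.pressure (-φ) ≤ 0), (T.doubleIntegral Q μ φ : EReal)

end Entropy

end Correspondence

section KernelEntropy

variable {X : Type*} [MeasurableSpace X]

theorem measurable_finSnoc (n : ℕ) :
    Measurable fun p : (Fin (n + 1) → X) × X => (Fin.snoc p.1 p.2 : Fin (n + 2) → X) := by
  refine measurable_pi_lambda _ fun i => ?_
  refine Fin.lastCases ?_ (fun j => ?_) i
  · simpa using measurable_snd
  · simp only [Fin.snoc_castSucc]
    exact (measurable_pi_apply j).comp measurable_fst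

/-- The kernel `Q^[n]` from `X` to `X^{n+1}`: the law of the first `n + 1` positions
`(x₀, …, xₙ)` of the Markov chain with transition kernel `Q` started at `x₀ = x`. -/
noncomputable def pathKernel (Q : Kernel X X) : (n : ℕ) → Kernel X (Fin (n + 1) → X)
  | 0 => Kernel.deterministic (fun x _ => x) (by fun_prop)
  | n + 1 =>
    (pathKernel Q n ⊗ₖ
      Q.comap (fun p : X × (Fin (n + 1) → X) => p.2 (Fin.last n)) (by fun_prop)).map
        fun p => Fin.snoc p.1 p.2

instance pathKernel_isMarkov (Q : Kernel X X) [IsMarkovKernel Q] (n : ℕ) :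
    IsMarkovKernel (pathKernel Q n) := by
  induction n with
  | zero => unfold pathKernel; infer_instance
  | succ n ih => unfold pathKernel; exact Kernel.IsMarkovKernel.map _ (measurable_finSnoc n)

/-- The recursion that defines `Q^[n]`. -/
theorem pathKernel_succ_apply (Q : Kernel X X) [IsMarkovKernel Q] (n : ℕ) (x : X)
    {A : Set (Fin (n + 2) → X)} (hA : MeasurableSet A) :
    pathKernel Q (n + 1) x A =
      ∫⁻ z, Q (z (Fin.last n)) {y | (Fin.snoc z y : Fin (n + 2) → X) ∈ A}
        ∂(pathKernel Q n x) := by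
  rw [pathKernel, Kernel.map_apply' _ (measurable_finSnoc n) _ hA,
    Kernel.compProd_apply (measurable_finSnoc n hA)]
  rfl

/-- A finite measurable partition of `X`, as a family of sets indexed by `{0, …, card - 1}`. -/
structure FinMeasPartition (X : Type*) [MeasurableSpace X] where
  /-- The number of members. -/
  card : ℕ
  /-- The members of the partition. -/
  part : Fin card → Set X
  measurableSet_part : ∀ i, MeasurableSet (part i)
  disjoint_part : Pairwise fun i j => Disjoint (part i) (part j)
  iUnion_part : ⋃ i, part i = Set.univ

/-- The Shannon entropy `H_ν(𝒜ⁿ) = -∑ ν(B) log ν(B)`, where `B = A₁ × ⋯ × Aₙ` runs over the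
members of the product partition `𝒜ⁿ` of `Xⁿ` (with `0 log 0 = 0`). -/
noncomputable def productEntropy {n : ℕ} (ν : Measure (Fin n → X)) (A : FinMeasPartition X) :
    ℝ :=
  ∑ s : Fin n → Fin A.card, Real.negMulLog (ν.real (Set.univ.pi fun i => A.part (s i)))

/-- The entropy `h_μ(Q, 𝒜) = lim_{n → ∞} (1/n) H_{μQ^[n-1]}(𝒜ⁿ)`, with `n` shifted by one.
The limit exists (by subadditivity) when `μ` is a `Q`-invariant probability measure, the case
in which it is used, so that it equals the upper limit taken here. -/
noncomputable def kernelEntropyPartition (Q : Kernel X X) (μ : Measure X)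
    (A : FinMeasPartition X) : EReal :=
  limsup (fun n : ℕ =>
    ((productEntropy (μ.bind (pathKernel Q n)) A / ((n : ℝ) + 1) : ℝ) : EReal)) atTop

/-- The measure-theoretic entropy `h_μ(Q)` of the kernel `Q` for `μ`: the supremum of
`h_μ(Q, 𝒜)` over all finite measurable partitions `𝒜` of `X`. -/
noncomputable def kernelEntropy (Q : Kernel X X) (μ : Measure X) : EReal :=
  ⨆ A : FinMeasPartition X, kernelEntropyPartition Q μ A

end KernelEntropy

/-! The argument is convex duality. The function $\phi\mapsto P(T,\phi)$ is convex and monotone,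
satisfies $P(T,\phi+c)=P(T,\phi)+c$, and is unchanged when a coboundary $u(y)-u(x)$ is added,
because Birkhoff sums of coboundaries telescope to bounded quantities. Translation by constants
turns the constraint $P(T,-\phi)\le0$ into the Legendre formula (iii) (`abstractEntropy_eq_iInf`),
and (iii) contains the upper bound in (i).

If $h_{\mathrm{top}}(T)<\infty$, the pressure is finite everywhere and has a linear subgradient at
$\phi$. Monotonicity makes the subgradient positive, translation makes it normalized, and coboundary
invariance makes it vanish on coboundaries. Riesz representation gives a probability measure on the
graph. Disintegration over the first marginal, corrected on a null set by a Borel selection of $T$,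
gives $\mathcal Q$; vanishing on coboundaries says that both marginals agree, so $\mu\mathcal Q=\mu$
(`exists_kernel_of_functional`). The subgradient inequality is then equality in (i). If
$h_{\mathrm{top}}(T)=\infty$, every pressure and every abstract entropy is $+\infty$, and any
invariant pair will do; orbit averages supply one.

For (ii), a maximizing pair is a subgradient, and along coboundaries the pressure is constant, so
the pair integrates coboundaries to zero.

By (iii), (iv) reduces to $h_\mu(\mathcal Q)\le P(T,\phi)-\iint\phi$ for every $\phi$. This is
Gibbs' inequality against an explicit mixture of product weights indexed by a separated net of
orbits (`productEntropy_le`). -/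

namespace Correspondence

/-! ### Compactness of the orbit spaces -/

section Topology

variable {X : Type*} [MetricSpace X]

theorem isClosed_graph (T : Correspondence X) : IsClosed T.graph := by
  rw [← isOpen_compl_iff, isOpen_iff_mem_nhds]
  rintro ⟨x, y⟩ hxy
  obtain ⟨U, V, hU, hV, hyU, hTV, hd⟩ :=
    normal_separation isClosed_singleton (T.isClosed' x)
      (Set.disjoint_singleton_left.2 hxy)
  have h := upperHemicontinuous_iff_forall_isOpen.1 T.upperHemicontinuous' x V hV hTV
  filter_upwards [prod_mem_nhds h (hU.mem_nhds (hyU rfl))] with p hp hp'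
  exact Set.disjoint_left.1 hd hp.2 (hp.1 hp')

instance [CompactSpace X] (T : Correspondence X) : CompactSpace T.graph :=
  isCompact_iff_compactSpace.1 T.isClosed_graph.isCompact

theorem isClosed_orbits (T : Correspondence X) (n : ℕ) : IsClosed (T.orbits n) := by
  have : T.orbits n = ⋂ i : Fin n, (fun x : Fin (n + 1) → X => (x i.castSucc, x i.succ)) ⁻¹'
      T.graph := by
    ext x; simp [orbits, graph]
  rw [this]
  exact isClosed_iInter fun i => T.isClosed_graph.preimage (by fun_prop)

instance [CompactSpace X] (T : Correspondence X) (n : ℕ) : CompactSpace (T.orbits n) :=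
  isCompact_iff_compactSpace.1 (T.isClosed_orbits n).isCompact

/-- An infinite orbit of `T`. -/
theorem exists_orbit [Nonempty X] (T : Correspondence X) :
    ∃ x : ℕ → X, ∀ n, x (n + 1) ∈ T.toFun (x n) := by
  choose f hf using T.nonempty'
  refine ⟨fun n => f^[n] (Classical.arbitrary X), fun n => ?_⟩
  simp only [Function.iterate_succ_apply']
  exact hf _

instance [Nonempty X] (T : Correspondence X) (n : ℕ) : Nonempty (T.orbits n) := by
  obtain ⟨x, hx⟩ := T.exists_orbit
  exact ⟨⟨fun i => x i, fun i => by simpa using hx i⟩⟩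

end Topology

/-! ### Convexity, monotonicity and coboundary invariance of the pressure -/

section Pressure

variable {X : Type*} [MetricSpace X] {T : Correspondence X} {φ ψ : C(T.graph, ℝ)} {ε a b : ℝ}
  {n : ℕ}

theorem separatedSum_le_ofReal_iff (ha : 0 ≤ a) :
    T.separatedSum φ ε n ≤ ENNReal.ofReal a ↔
      ∀ E : Finset (T.orbits n), (E : Set (T.orbits n)).Pairwise (fun x y => ε ≤ dist x y) →
        ∑ x ∈ E, Real.exp (T.birkhoff φ n x) ≤ a := by
  simp only [separatedSum, iSup_le_iff]
  refine forall₂_congr fun E _ => ?_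
  rw [← ENNReal.ofReal_sum_of_nonneg fun _ _ => (Real.exp_pos _).le,
    ENNReal.ofReal_le_ofReal_iff ha]

theorem log_div_le_coe_iff (hn : 0 < n) {s : ℝ≥0∞} :
    ENNReal.log s / (n : EReal) ≤ (a : EReal) ↔ s ≤ ENNReal.ofReal (Real.exp (n * a)) := by
  rw [EReal.div_le_iff_le_mul (by exact_mod_cast hn) (EReal.natCast_ne_top n),
    ← ENNReal.log_le_log_iff (y := ENNReal.ofReal _), ENNReal.log_ofReal_of_pos (Real.exp_pos _),
    Real.log_exp, EReal.coe_mul]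
  rfl

/-- The additive constant `K` disappears after division by `n`; it leaves room for bounded errors
such as those of coboundaries. -/
theorem pressureAt_le_coe (K : ℝ)
    (h : ∀ᶠ n : ℕ in atTop, ∀ E : Finset (T.orbits n),
      (E : Set (T.orbits n)).Pairwise (fun x y => ε ≤ dist x y) →
        ∑ x ∈ E, Real.exp (T.birkhoff φ n x) ≤ Real.exp (n * a + K)) :
    T.pressureAt φ ε ≤ a := by
  rw [← EReal.le_of_forall_lt_iff_le]
  intro b hab
  replace hab : a < b := by exact_mod_cast hab
  refine limsup_le_of_le (by isBoundedDefault) ?_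
  have hK : ∀ᶠ n : ℕ in atTop, K ≤ n * (b - a) :=
    (tendsto_natCast_atTop_atTop.atTop_mul_const (sub_pos.2 hab)).eventually_ge_atTop K
  filter_upwards [h, hK, eventually_gt_atTop 0] with n hn hK h0
  rw [log_div_le_coe_iff h0, separatedSum_le_ofReal_iff (Real.exp_pos _).le]
  intro E hE
  exact (hn E hE).trans (Real.exp_le_exp.2 (by linarith))

theorem eventually_sum_le_of_pressureAt_lt (h : T.pressureAt φ ε < a) :
    ∀ᶠ n : ℕ in atTop, ∀ E : Finset (T.orbits n),
      (E : Set (T.orbits n)).Pairwise (fun x y => ε ≤ dist x y) →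
        ∑ x ∈ E, Real.exp (T.birkhoff φ n x) ≤ Real.exp (n * a) := by
  filter_upwards [eventually_lt_of_limsup_lt h, eventually_gt_atTop 0] with n hn h0
  rw [← separatedSum_le_ofReal_iff (Real.exp_pos _).le, ← log_div_le_coe_iff h0]
  exact hn.le

theorem pressureAt_le_pressure (hε : 0 < ε) : T.pressureAt φ ε ≤ T.pressure φ :=
  le_iSup₂ (f := fun (ε : ℝ) (_ : 0 < ε) => T.pressureAt φ ε) ε hε

theorem pressure_le_coe (h : ∀ ε > 0, T.pressureAt φ ε ≤ a) : T.pressure φ ≤ a :=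
  iSup₂_le h

/-- If the Birkhoff sums of `ψ` exceed those of `φ` by at most `c n + K`, then the pressure of
`ψ` exceeds that of `φ` by at most `c`. -/
theorem pressure_le_add_of_birkhoff_le (c K : ℝ)
    (h : ∀ n x, T.birkhoff ψ n x ≤ T.birkhoff φ n x + n * c + K) :
    T.pressure ψ ≤ T.pressure φ + c := by
  refine EReal.le_of_forall_lt_iff_le.1 fun b hb => pressure_le_coe fun ε hε => ?_
  have hb' : T.pressureAt φ ε < ((b - c : ℝ) : EReal) := by
    refine (pressureAt_le_pressure hε).trans_lt ?_
    rw [EReal.coe_sub]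
    exact EReal.lt_sub_iff_add_lt (by simp) (by simp) |>.2 hb
  refine pressureAt_le_coe K ?_
  filter_upwards [eventually_sum_le_of_pressureAt_lt hb'] with n hn E hE
  calc ∑ x ∈ E, Real.exp (T.birkhoff ψ n x)
      ≤ ∑ x ∈ E, Real.exp (T.birkhoff φ n x) * Real.exp (n * c + K) :=
        Finset.sum_le_sum fun x _ => by
          rw [← Real.exp_add]; exact Real.exp_le_exp.2 (by linarith [h n x])
    _ = (∑ x ∈ E, Real.exp (T.birkhoff φ n x)) * Real.exp (n * c + K) := by
        rw [Finset.sum_mul]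
    _ ≤ Real.exp (n * (b - c)) * Real.exp (n * c + K) := by gcongr; exact hn E hE
    _ = Real.exp (n * b + K) := by rw [← Real.exp_add]; congr 1; ring

theorem pressure_le_add_of_le (c : ℝ) (h : ∀ p, ψ p ≤ φ p + c) :
    T.pressure ψ ≤ T.pressure φ + c := by
  refine pressure_le_add_of_birkhoff_le c 0 fun n x => ?_
  calc T.birkhoff ψ n x ≤ ∑ i : Fin n, (φ ⟨(x.1 i.castSucc, x.1 i.succ), x.2 i⟩ + c) :=
        Finset.sum_le_sum fun i _ => h _
    _ = T.birkhoff φ n x + n * c + 0 := by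
        simp [Finset.sum_add_distrib, birkhoff]

theorem pressure_add_const (φ : C(T.graph, ℝ)) (c : ℝ) :
    T.pressure (φ + ContinuousMap.const _ c) = T.pressure φ + c := by
  refine le_antisymm (pressure_le_add_of_le c fun p => by simp) ?_
  have := pressure_le_add_of_le (φ := φ + ContinuousMap.const _ c) (ψ := φ) (-c)
    fun p => by simp
  calc T.pressure φ + c ≤ T.pressure (φ + ContinuousMap.const _ c) + ((-c : ℝ) : EReal) + c := by
        gcongr
    _ = _ := by rw [add_assoc, ← EReal.coe_add]; simp

/-- The coboundary `(x, y) ↦ u y - u x` on the graph of `T`. -/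
def coboundary (T : Correspondence X) (u : C(X, ℝ)) : C(T.graph, ℝ) where
  toFun p := u p.1.2 - u p.1.1

theorem birkhoff_add (φ ψ : C(T.graph, ℝ)) (x : T.orbits n) :
    T.birkhoff (φ + ψ) n x = T.birkhoff φ n x + T.birkhoff ψ n x := by
  simp [birkhoff, Finset.sum_add_distrib]

theorem birkhoff_smul (c : ℝ) (φ : C(T.graph, ℝ)) (x : T.orbits n) :
    T.birkhoff (c • φ) n x = c * T.birkhoff φ n x := by
  simp [birkhoff, Finset.mul_sum]

theorem birkhoff_coboundary (u : C(X, ℝ)) (x : T.orbits n) :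
    T.birkhoff (T.coboundary u) n x = u (x.1 (Fin.last n)) - u (x.1 0) := by
  simp only [birkhoff, coboundary, ContinuousMap.coe_mk, Finset.sum_sub_distrib]
  have h1 := Fin.sum_univ_succ fun i => u (x.1 i)
  have h2 := Fin.sum_univ_castSucc fun i => u (x.1 i)
  linarith

/-- Convexity of the pressure, stated through strict real upper bounds so that no subtraction of
extended reals occurs. The same separated set `E` serves both functions. -/
theorem pressure_combo_le {s t : ℝ} (hs : 0 ≤ s) (ht : 0 ≤ t) (hst : s + t = 1)
    (ha : T.pressure φ < a) (hb : T.pressure ψ < b) :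
    T.pressure (s • φ + t • ψ) ≤ ((s * a + t * b : ℝ) : EReal) := by
  refine pressure_le_coe fun ε hε => pressureAt_le_coe 0 ?_
  filter_upwards [eventually_sum_le_of_pressureAt_lt ((pressureAt_le_pressure hε).trans_lt ha),
    eventually_sum_le_of_pressureAt_lt ((pressureAt_le_pressure hε).trans_lt hb)] with n h1 h2 E hE
  specialize h1 E hE
  specialize h2 E hE
  -- Normalizing by `exp (n * a)` and `exp (n * b)` lets convexity of the exponential, applied
  -- pointwise, replace Hölder's inequality.
  have hle : ∀ x ∈ E, Real.exp (T.birkhoff (s • φ + t • ψ) n x) ≤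
      Real.exp (n * (s * a + t * b)) * (s * (Real.exp (T.birkhoff φ n x) * Real.exp (-(n * a))) +
        t * (Real.exp (T.birkhoff ψ n x) * Real.exp (-(n * b)))) := fun x _ => by
    have hc := convexOn_exp.2 (Set.mem_univ (T.birkhoff φ n x + -(n * a)))
      (Set.mem_univ (T.birkhoff ψ n x + -(n * b))) hs ht hst
    simp only [smul_eq_mul, Real.exp_add] at hc
    refine le_trans (le_of_eq ?_) (mul_le_mul_of_nonneg_left hc (Real.exp_pos _).le)
    rw [birkhoff_add, birkhoff_smul, birkhoff_smul, ← Real.exp_add, ← Real.exp_add]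
    congr 1; ring
  calc _ ≤ _ := Finset.sum_le_sum hle
    _ = Real.exp (n * (s * a + t * b)) *
        (s * ((∑ x ∈ E, Real.exp (T.birkhoff φ n x)) * Real.exp (-(n * a))) +
          t * ((∑ x ∈ E, Real.exp (T.birkhoff ψ n x)) * Real.exp (-(n * b)))) := by
        simp only [Finset.mul_sum, Finset.sum_mul, ← Finset.sum_add_distrib]
    _ ≤ Real.exp (n * (s * a + t * b)) *
        (s * (Real.exp (n * a) * Real.exp (-(n * a))) +
          t * (Real.exp (n * b) * Real.exp (-(n * b)))) := by gcongr
    _ = Real.exp (n * (s * a + t * b) + 0) := by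
        rw [← Real.exp_add, ← Real.exp_add]; simp [hst]

variable [CompactSpace X]

theorem pressure_add_coboundary (φ : C(T.graph, ℝ)) (u : C(X, ℝ)) :
    T.pressure (φ + T.coboundary u) = T.pressure φ := by
  have hu : ∀ x, |u x| ≤ ‖u‖ := fun x => u.norm_coe_le_norm x
  refine le_antisymm ?_ ?_
  · simpa using pressure_le_add_of_birkhoff_le (φ := φ) (ψ := φ + T.coboundary u) 0 (2 * ‖u‖)
      fun n x => by
        rw [birkhoff_add, birkhoff_coboundary]
        linarith [(abs_le.1 (hu (x.1 (Fin.last n)))).2, (abs_le.1 (hu (x.1 0))).1]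
  · simpa using pressure_le_add_of_birkhoff_le (ψ := φ) (φ := φ + T.coboundary u) 0 (2 * ‖u‖)
      fun n x => by
        rw [birkhoff_add, birkhoff_coboundary]
        linarith [(abs_le.1 (hu (x.1 (Fin.last n)))).1, (abs_le.1 (hu (x.1 0))).2]

theorem pressure_le_add_norm_sub (φ ψ : C(T.graph, ℝ)) :
    T.pressure ψ ≤ T.pressure φ + (‖ψ - φ‖ : ℝ) :=
  pressure_le_add_of_le _ fun p => by
    have := (abs_le.1 ((ψ - φ).norm_coe_le_norm p)).2
    simp only [ContinuousMap.sub_apply] at this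
    linarith

/-- A single orbit is a separated set, so the pressure of `0` is nonnegative; the Lipschitz bound
carries this over to every `φ`. -/
theorem pressure_ne_bot [Nonempty X] (φ : C(T.graph, ℝ)) : T.pressure φ ≠ ⊥ := by
  have h0 : (0 : EReal) ≤ T.pressure 0 := by
    refine le_trans ?_ (pressureAt_le_pressure (φ := 0) one_pos)
    refine le_limsup_of_frequently_le (Frequently.of_forall fun n => ?_) (by isBoundedDefault)
    refine EReal.div_nonneg (ENNReal.zero_le_log_iff.2 ?_) (by positivity)
    refine le_iSup₂_of_le {Classical.arbitrary (T.orbits n)} (by simp) ?_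
    simp [birkhoff]
  have h := h0.trans (pressure_le_add_norm_sub φ 0)
  intro hb
  simp [hb] at h

theorem pressure_eq_top_iff [Nonempty X] (φ : C(T.graph, ℝ)) :
    T.pressure φ = ⊤ ↔ T.topEntropy = ⊤ := by
  have key : ∀ φ ψ : C(T.graph, ℝ), T.pressure ψ = ⊤ → T.pressure φ = ⊤ := fun φ ψ h => by
    have h1 := pressure_le_add_norm_sub φ ψ
    rw [h, top_le_iff] at h1
    by_contra hne
    exact (EReal.add_lt_top hne (EReal.coe_ne_top _)).ne h1
  exact ⟨key _ _, key _ _⟩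

theorem coe_toReal_pressure [Nonempty X] (h : T.topEntropy < ⊤) (φ : C(T.graph, ℝ)) :
    ((T.pressure φ).toReal : EReal) = T.pressure φ :=
  EReal.coe_toReal (fun h' => h.ne ((pressure_eq_top_iff φ).1 h')) (pressure_ne_bot φ)

end Pressure

end Correspondence

/-! ### Subgradients and Riesz representation -/

section FunctionalAnalysis

/-- A convex function on a real vector space has a subgradient at every point. -/
theorem ConvexOn.exists_linearMap_le_sub {E : Type*} [AddCommGroup E] [Module ℝ E] {F : E → ℝ}
    (hF : ConvexOn ℝ Set.univ F) (x : E) :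
    ∃ g : E →ₗ[ℝ] ℝ, ∀ y, g y ≤ F (x + y) - F x := by
  let D : E → Set.Ioi (0 : ℝ) → ℝ := fun y t => (F (x + t.1 • y) - F x) / t.1
  -- The point `x` is a convex combination of `x + t • y` and `x - y`, which bounds the difference
  -- quotients below uniformly in `t`.
  have hlow : ∀ y t, -(F (x - y) - F x) ≤ D y t := fun y t => by
    have ht : 0 < t.1 := t.2
    have h1 : 0 < 1 + t.1 := by linarith
    have := hF.2 (Set.mem_univ (x + t.1 • y)) (Set.mem_univ (x - y))
      (by positivity : 0 ≤ 1 / (1 + t.1)) (by positivity : 0 ≤ t.1 / (1 + t.1)) (by field_simp)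
    rw [show (1 / (1 + t.1)) • (x + t.1 • y) + (t.1 / (1 + t.1)) • (x - y) = x by
      match_scalars
      · field_simp
      · field_simp; ring] at this
    simp only [smul_eq_mul] at this
    rw [le_div_iff₀ ht]
    have h2 := mul_le_mul_of_nonneg_left this h1.le
    have h3 : (1 + t.1) * (1 / (1 + t.1) * F (x + t.1 • y) + t.1 / (1 + t.1) * F (x - y)) =
      F (x + t.1 • y) + t.1 * F (x - y) := by field_simp
    rw [h3] at h2
    linarith
  have hbdd : ∀ y, BddBelow (Set.range (D y)) := fun y =>
    ⟨_, Set.forall_mem_range.2 (hlow y)⟩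
  have : Nonempty (Set.Ioi (0 : ℝ)) := ⟨⟨1, Set.mem_Ioi.2 one_pos⟩⟩
  -- The infimum of the difference quotients is the directional derivative. It is sublinear, and
  -- Hahn–Banach extends from the zero subspace; no topology is involved.
  obtain ⟨g, -, hg⟩ := exists_extension_of_le_sublinear (⊥ : E →ₗ.[ℝ] ℝ) (fun y => ⨅ t, D y t)
    (fun c hc y => by
      rw [Real.mul_iInf_of_nonneg hc.le]
      refine le_antisymm ?_ ?_
      · refine le_ciInf fun t => (ciInf_le (hbdd _) ⟨t.1 / c, div_pos t.2 hc⟩).trans ?_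
        have ht : 0 < t.1 := t.2
        simp only [D, smul_smul, div_mul_cancel₀ _ hc.ne']
        apply le_of_eq; field_simp
      · refine le_ciInf fun t => ?_
        have ht : 0 < t.1 := t.2
        refine (ciInf_le ?_ (⟨t.1 * c, mul_pos ht hc⟩ : Set.Ioi (0 : ℝ))).trans ?_
        · obtain ⟨m, hm⟩ := hbdd y
          exact ⟨c * m, Set.forall_mem_range.2 fun t =>
            mul_le_mul_of_nonneg_left (hm ⟨t, rfl⟩) hc.le⟩
        simp only [D, smul_smul]
        apply le_of_eq; field_simp)
    (fun y z => by
      refine le_ciInf_add_ciInf fun s t => ?_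
      have hs : 0 < s.1 := s.2
      have ht : 0 < t.1 := t.2
      -- With step `s t / (s + t)` in direction `y + z`, the point reached is a convex combination
      -- of `x + s • y` and `x + t • z`.
      refine (ciInf_le (hbdd _)
        ⟨s.1 * t.1 / (s.1 + t.1), div_pos (mul_pos hs ht) (add_pos hs ht)⟩).trans ?_
      have := hF.2 (Set.mem_univ (x + s.1 • y)) (Set.mem_univ (x + t.1 • z))
        (by positivity : 0 ≤ t.1 / (s.1 + t.1)) (by positivity : 0 ≤ s.1 / (s.1 + t.1))
        (by field_simp; ring)
      rw [show (t.1 / (s.1 + t.1)) • (x + s.1 • y) + (s.1 / (s.1 + t.1)) • (x + t.1 • z) =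
        x + (s.1 * t.1 / (s.1 + t.1)) • (y + z) by
          match_scalars <;> field_simp
          ring] at this
      simp only [smul_eq_mul] at this
      simp only [D]
      rw [div_le_iff₀ (by positivity)]
      have h3 : ((F (x + s.1 • y) - F x) / s.1 + (F (x + t.1 • z) - F x) / t.1) *
        (s.1 * t.1 / (s.1 + t.1)) = (t.1 / (s.1 + t.1) * F (x + s.1 • y) +
          s.1 / (s.1 + t.1) * F (x + t.1 • z)) - F x := by field_simp; ring
      rw [h3]
      linarith)
    (fun y => by
      have : y = 0 := Subtype.ext ((Submodule.mem_bot ℝ).1 y.2)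
      subst this
      simp [D])
  refine ⟨g, fun y => (hg y).trans ((ciInf_le (hbdd y) ⟨1, Set.mem_Ioi.2 one_pos⟩).trans ?_)⟩
  simp [D]

/-- The Riesz representation theorem for normalized positive functionals on a compact space. -/
theorem exists_isProbabilityMeasure_integral_eq {K : Type*} [TopologicalSpace K] [T2Space K]
    [CompactSpace K] [MeasurableSpace K] [BorelSpace K] (g : C(K, ℝ) →ₗ[ℝ] ℝ)
    (hpos : ∀ f, (∀ p, 0 ≤ f p) → 0 ≤ g f) (hone : g 1 = 1) :
    ∃ ν : Measure K, IsProbabilityMeasure ν ∧ ∀ f : C(K, ℝ), ∫ p, f p ∂ν = g f := by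
  let Λ : CompactlySupportedContinuousMap K ℝ →ₚ[ℝ] ℝ := PositiveLinearMap.mk₀
    { toFun := fun f => g f.toContinuousMap
      map_add' := fun f f' => g.map_add f.toContinuousMap f'.toContinuousMap
      map_smul' := fun c f => g.map_smul c f.toContinuousMap } fun f hf => hpos _ fun p => hf p
  have hΛ : ∀ f : C(K, ℝ), ∫ p, f p ∂(RealRMK.rieszMeasure Λ) = g f := fun f =>
    RealRMK.integral_rieszMeasure Λ (CompactlySupportedContinuousMap.continuousMapEquiv f)
  refine ⟨RealRMK.rieszMeasure Λ, ⟨?_⟩, hΛ⟩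
  have h1 := hΛ 1
  simp only [ContinuousMap.one_apply, integral_const, smul_eq_mul, mul_one, hone] at h1
  rw [Measure.real, ENNReal.toReal_eq_one_iff] at h1
  exact h1

end FunctionalAnalysis

/-! ### Kernels supported by the correspondence, and functionals on its graph -/

namespace Correspondence

theorem norm_extend_le {X : Type*} [MetricSpace X] [CompactSpace X] {T : Correspondence X}
    (φ : C(T.graph, ℝ)) (p : X × X) :
    ‖Function.extend Subtype.val φ 0 p‖ ≤ ‖φ‖ := by
  by_cases hp : ∃ q : T.graph, q.1 = p
  · obtain ⟨q, rfl⟩ := hp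
    rw [Subtype.val_injective.extend_apply]
    exact φ.norm_coe_le_norm q
  · rw [Function.extend_apply' _ _ _ hp]
    simp

variable {X : Type*} [MetricSpace X] [MeasurableSpace X] [BorelSpace X]

theorem measurableSet_toFun (T : Correspondence X) (x : X) : MeasurableSet (T.toFun x) :=
  (T.isClosed' x).measurableSet

theorem Supports.ae_mem {T : Correspondence X} {Q : Kernel X X} [IsMarkovKernel Q]
    (hQ : T.Supports Q) (x : X) : ∀ᵐ y ∂(Q x), y ∈ T.toFun x :=
  (prob_compl_eq_zero_iff (T.measurableSet_toFun x)).2 (hQ x)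

variable [CompactSpace X]

theorem measurableSet_graph (T : Correspondence X) : MeasurableSet T.graph :=
  T.isClosed_graph.measurableSet

/-- A correspondence on a compact metric space has a Borel selection. -/
theorem exists_measurable_selection [Nonempty X] (T : Correspondence X) :
    ∃ f : X → X, Measurable f ∧ ∀ x, f x ∈ T.toFun x := by
  -- Parametrizing `X` by the Cantor set, a subset of the line, allows the selection of the point
  -- with least parameter in `T x`.
  obtain ⟨g₀, hg₀, hsurj₀⟩ := exists_nat_bool_continuous_surjective_of_compact X
  let g : cantorSet → X := g₀ ∘ cantorSetHomeomorphNatToBool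
  have hg : Continuous g := hg₀.comp cantorSetHomeomorphNatToBool.continuous
  have hsurj : Function.Surjective g := hsurj₀.comp cantorSetHomeomorphNatToBool.surjective
  have : CompactSpace cantorSet := isCompact_iff_compactSpace.1 isCompact_cantorSet
  have hmin : ∀ x, ∃ c : cantorSet, g c ∈ T.toFun x ∧
      ∀ c' : cantorSet, g c' ∈ T.toFun x → c.1 ≤ c'.1 := fun x => by
    obtain ⟨y, hy⟩ := T.nonempty' x
    obtain ⟨c₀, rfl⟩ := hsurj y
    obtain ⟨c, hc, hc'⟩ := ((T.isClosed' x).preimage hg).isCompact.exists_isMinOn ⟨c₀, hy⟩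
      continuous_subtype_val.continuousOn
    exact ⟨c, hc, fun c' h => hc' h⟩
  choose m hm hm' using hmin
  refine ⟨fun x => g (m x), hg.measurable.comp ?_, hm⟩
  suffices h : Measurable fun x => (m x : ℝ) from h.subtype_mk
  refine measurable_of_Iic fun a => ?_
  -- The sublevel sets of the least parameter are projections of compact sets, hence closed.
  have : (fun x => (m x : ℝ)) ⁻¹' Set.Iic a =
      Prod.fst '' ({p : X × cantorSet | (p.1, g p.2) ∈ T.graph} ∩ {p | (p.2 : ℝ) ≤ a}) := by
    ext x
    simp only [Set.mem_preimage, Set.mem_Iic, Set.mem_image, Set.mem_inter_iff, Set.mem_ofPred_eq,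
      Prod.exists, exists_and_right, exists_eq_right]
    exact ⟨fun h => ⟨m x, hm x, h⟩, fun ⟨c, hc, hca⟩ => (hm' x c hc).trans hca⟩
  rw [this]
  refine (IsCompact.image (IsClosed.isCompact ?_) continuous_fst).measurableSet
  refine (T.isClosed_graph.preimage ?_).inter (isClosed_le ?_ continuous_const)
  · exact continuous_fst.prodMk (hg.comp continuous_snd)
  · exact continuous_subtype_val.comp continuous_snd

/-- The joint law of two consecutive positions, as a measure on the graph of `T`. -/
noncomputable def graphMeasure (T : Correspondence X) (Q : Kernel X X) (μ : Measure X) :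
    Measure T.graph :=
  (μ ⊗ₘ Q).comap Subtype.val

section DoubleIntegral

variable {T : Correspondence X} {Q : Kernel X X} {μ : Measure X} [IsMarkovKernel Q]

theorem Supports.ae_mem_graph [SFinite μ] (hQ : T.Supports Q) : ∀ᵐ p ∂(μ ⊗ₘ Q), p ∈ T.graph :=
  Measure.ae_compProd_of_ae_ae T.measurableSet_graph (.of_forall hQ.ae_mem)

variable [IsProbabilityMeasure μ]

theorem Supports.isProbabilityMeasure_graphMeasure (hQ : T.Supports Q) :
    IsProbabilityMeasure (T.graphMeasure Q μ) := by
  constructor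
  rw [graphMeasure, (MeasurableEmbedding.subtype_coe T.measurableSet_graph).comap_apply,
    Set.image_univ, Subtype.range_coe]
  exact (prob_compl_eq_zero_iff T.measurableSet_graph).1 hQ.ae_mem_graph

theorem Supports.integral_graphMeasure (hQ : T.Supports Q) (f : X × X → ℝ) :
    ∫ p : T.graph, f p ∂(T.graphMeasure Q μ) = ∫ p, f p ∂(μ ⊗ₘ Q) := by
  rw [graphMeasure, integral_subtype_comap T.measurableSet_graph,
    Measure.restrict_eq_self_of_ae_mem hQ.ae_mem_graph]

theorem measurable_extend (φ : C(T.graph, ℝ)) :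
    Measurable (Function.extend Subtype.val φ (0 : X × X → ℝ)) :=
  (MeasurableEmbedding.subtype_coe T.measurableSet_graph).measurable_extend φ.measurable
    measurable_zero

theorem integrable_extend (φ : C(T.graph, ℝ)) (ρ : Measure (X × X)) [IsFiniteMeasure ρ] :
    Integrable (Function.extend Subtype.val φ (0 : X × X → ℝ)) ρ :=
  .of_bound (measurable_extend φ).aestronglyMeasurable ‖φ‖ (.of_forall (norm_extend_le φ))

theorem Supports.doubleIntegral_eq_integral_extend (hQ : T.Supports Q) (φ : C(T.graph, ℝ)) :
    T.doubleIntegral Q μ φ = ∫ p, Function.extend Subtype.val φ 0 p ∂(μ ⊗ₘ Q) := by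
  rw [Measure.integral_compProd (integrable_extend φ _), doubleIntegral]
  exact integral_congr_ae (.of_forall fun x => by
    simp only [Measure.restrict_eq_self_of_ae_mem (hQ.ae_mem x)])

theorem Supports.doubleIntegral_eq (hQ : T.Supports Q) (φ : C(T.graph, ℝ)) :
    T.doubleIntegral Q μ φ = ∫ p, φ p ∂(T.graphMeasure Q μ) := by
  rw [hQ.doubleIntegral_eq_integral_extend, ← hQ.integral_graphMeasure]
  simp only [Subtype.val_injective.extend_apply]

theorem integrable_graphMeasure (hQ : T.Supports Q) (φ : C(T.graph, ℝ)) :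
    Integrable φ (T.graphMeasure Q μ) :=
  have := hQ.isProbabilityMeasure_graphMeasure (μ := μ)
  φ.continuous.integrable_of_hasCompactSupport (.of_compactSpace _)

theorem Supports.doubleIntegral_add (hQ : T.Supports Q) (φ ψ : C(T.graph, ℝ)) :
    T.doubleIntegral Q μ (φ + ψ) = T.doubleIntegral Q μ φ + T.doubleIntegral Q μ ψ := by
  simp only [hQ.doubleIntegral_eq]
  exact integral_add (integrable_graphMeasure hQ φ) (integrable_graphMeasure hQ ψ)

theorem Supports.doubleIntegral_neg (hQ : T.Supports Q) (φ : C(T.graph, ℝ)) :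
    T.doubleIntegral Q μ (-φ) = -T.doubleIntegral Q μ φ := by
  simp only [hQ.doubleIntegral_eq]
  exact integral_neg _

theorem Supports.doubleIntegral_const (hQ : T.Supports Q) (c : ℝ) :
    T.doubleIntegral Q μ (ContinuousMap.const _ c) = c := by
  have := hQ.isProbabilityMeasure_graphMeasure (μ := μ)
  simp [hQ.doubleIntegral_eq]

theorem Supports.doubleIntegral_coboundary (hQ : T.Supports Q) (u : C(X, ℝ)) :
    T.doubleIntegral Q μ (T.coboundary u) = ∫ x, u x ∂(μ.bind Q) - ∫ x, u x ∂μ := by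
  have h1 : ∫ p, u p.1 ∂(μ ⊗ₘ Q) = ∫ x, u x ∂μ := by
    conv_rhs => rw [← Measure.fst_compProd μ Q]
    exact (integral_map (by fun_prop) (by fun_prop)).symm
  have h2 : ∫ p, u p.2 ∂(μ ⊗ₘ Q) = ∫ x, u x ∂(μ.bind Q) := by
    rw [← Measure.snd_compProd μ Q]
    exact (integral_map (by fun_prop) (by fun_prop)).symm
  rw [hQ.doubleIntegral_eq, ← h1, ← h2]
  have hc : ∀ f : C(X × X, ℝ), Integrable f (μ ⊗ₘ Q) := fun f =>
    f.continuous.integrable_of_hasCompactSupport (.of_compactSpace _)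
  rw [← integral_sub (f := fun p : X × X => u p.2) (g := fun p => u p.1)
    (hc ⟨fun p => u p.2, by fun_prop⟩) (hc ⟨fun p => u p.1, by fun_prop⟩),
    ← hQ.integral_graphMeasure]
  rfl

/-- `μ` is invariant if coboundaries have zero integral. -/
theorem Supports.invariant_of_doubleIntegral_coboundary (hQ : T.Supports Q)
    (h : ∀ u : C(X, ℝ), T.doubleIntegral Q μ (T.coboundary u) = 0) : Q.Invariant μ := by
  refine ext_of_forall_integral_eq_of_IsFiniteMeasure fun u => ?_
  have := hQ.doubleIntegral_coboundary (μ := μ) u.toContinuousMap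
  rw [h] at this
  exact (sub_eq_zero.1 this.symm)

end DoubleIntegral

/-- Every normalized positive functional on `C(T.graph, ℝ)` that vanishes on coboundaries comes
from a kernel supported by `T` and an invariant measure. -/
theorem exists_kernel_of_functional [Nonempty X] (T : Correspondence X)
    (g : C(T.graph, ℝ) →ₗ[ℝ] ℝ) (hpos : ∀ f, (∀ p, 0 ≤ f p) → 0 ≤ g f) (hone : g 1 = 1)
    (hcob : ∀ u, g (T.coboundary u) = 0) :
    ∃ (Q : Kernel X X) (μ : Measure X), IsMarkovKernel Q ∧ T.Supports Q ∧
      IsProbabilityMeasure μ ∧ Q.Invariant μ ∧ ∀ φ, T.doubleIntegral Q μ φ = g φ := by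
  obtain ⟨ν, hν, hνg⟩ := exists_isProbabilityMeasure_integral_eq g hpos hone
  have hemb := MeasurableEmbedding.subtype_coe T.measurableSet_graph
  let ρ : Measure (X × X) := ν.map Subtype.val
  have : IsProbabilityMeasure ρ := Measure.isProbabilityMeasure_map (by fun_prop)
  have hρ : ∀ᵐ p ∂ρ, p ∈ T.graph :=
    (ae_map_iff (by fun_prop) T.measurableSet_graph).2 (.of_forall fun p => p.2)
  have hdis : ρ.fst ⊗ₘ ρ.condKernel = ρ := ρ.disintegrate ρ.condKernel
  obtain ⟨f, hf, hfT⟩ := T.exists_measurable_selection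
  -- The conditional kernel is concentrated on `T x` only for almost every `x`. Off `G`, a null set,
  -- the selection replaces it, so that the support condition holds at every point.
  let G : Set X := {x | ρ.condKernel x (T.toFun x) = 1}
  have hG : MeasurableSet G :=
    Kernel.measurable_kernel_prodMk_left (κ := ρ.condKernel) T.measurableSet_graph
      (measurableSet_singleton 1)
  classical
  let Q : Kernel X X := Kernel.piecewise hG ρ.condKernel (Kernel.deterministic f hf)
  have hGae : ∀ᵐ x ∂ρ.fst, x ∈ G := by
    rw [← hdis] at hρ
    filter_upwards [Measure.ae_ae_of_ae_compProd hρ] with x hx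
    exact (prob_compl_eq_zero_iff (T.measurableSet_toFun x)).1 hx
  have hQ : T.Supports Q := fun x => by
    rw [Kernel.piecewise_apply']
    split_ifs with h
    · exact h
    · rw [Kernel.deterministic_apply' hf _ (T.measurableSet_toFun x), Set.indicator_of_mem (hfT x)]
  have hQρ : ρ.fst ⊗ₘ Q = ρ := by
    conv_rhs => rw [← hdis]
    refine Measure.compProd_congr ?_
    filter_upwards [hGae] with x hx
    rw [Kernel.piecewise_apply, if_pos hx]
  have hint : ∀ φ, T.doubleIntegral Q ρ.fst φ = g φ := fun φ => by
    rw [hQ.doubleIntegral_eq, graphMeasure, hQρ, hemb.comap_map, hνg]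
  exact ⟨Q, ρ.fst, inferInstance, hQ, inferInstance,
    hQ.invariant_of_doubleIntegral_coboundary fun u => by rw [hint, hcob], hint⟩

/-- A convex, monotone, translation-equivariant functional that does not see coboundaries has at
every point a subgradient that is given by an invariant measure. -/
theorem exists_kernel_subgradient [Nonempty X] (T : Correspondence X) {F : C(T.graph, ℝ) → ℝ}
    (hF : ConvexOn ℝ Set.univ F)
    (hmono : ∀ (φ ψ : C(T.graph, ℝ)) (c : ℝ), (∀ p, ψ p ≤ φ p + c) → F ψ ≤ F φ + c)
    (hcob : ∀ φ u, F (φ + T.coboundary u) = F φ) (φ : C(T.graph, ℝ)) :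
    ∃ (Q : Kernel X X) (μ : Measure X), IsMarkovKernel Q ∧ T.Supports Q ∧
      IsProbabilityMeasure μ ∧ Q.Invariant μ ∧
      ∀ ψ, F φ - T.doubleIntegral Q μ φ ≤ F ψ - T.doubleIntegral Q μ ψ := by
  obtain ⟨g, hg⟩ := hF.exists_linearMap_le_sub φ
  -- This bound gives positivity with `-f` and `0`, and normalization with `±1`.
  have key : ∀ ψ c, (∀ p, ψ p ≤ c) → g ψ ≤ c := fun ψ c h => by
    have := hmono φ (φ + ψ) c fun p => by simpa using h p
    linarith [hg ψ]
  obtain ⟨Q, μ, h1, h2, h3, h4, h5⟩ := T.exists_kernel_of_functional g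
    (fun f hf => by
      have := key (-f) 0 fun p => by simpa using hf p
      rw [map_neg] at this
      linarith)
    (by
      have := key (-1) (-1) fun p => by simp
      rw [map_neg] at this
      linarith [key 1 1 fun p => by simp])
    (fun u => by
      have h1 := hg (T.coboundary u)
      have h2 := hg (T.coboundary (-u))
      rw [hcob, sub_self] at h1 h2
      have : T.coboundary (-u) = -T.coboundary u := by
        ext p; simp [coboundary]; ring
      rw [this, map_neg] at h2
      linarith)
  refine ⟨Q, μ, h1, h2, h3, h4, fun ψ => ?_⟩
  have := hg (ψ - φ)
  rw [add_sub_cancel, map_sub] at this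
  rw [h5, h5]
  linarith

/-- There is a kernel supported by `T` with an invariant measure. -/
theorem exists_invariant [Nonempty X] (T : Correspondence X) :
    ∃ (Q : Kernel X X) (μ : Measure X), IsMarkovKernel Q ∧ T.Supports Q ∧
      IsProbabilityMeasure μ ∧ Q.Invariant μ := by
  obtain ⟨x, hx⟩ := T.exists_orbit
  let e : ℕ → T.graph := fun n => ⟨(x n, x (n + 1)), hx n⟩
  let A : C(T.graph, ℝ) → ℕ → ℝ := fun φ n => (∑ i ∈ Finset.range n, φ (e i)) / n
  have hA : ∀ φ n, A φ n ∈ Set.Icc (-‖φ‖) ‖φ‖ := fun φ n => by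
    have h : |∑ i ∈ Finset.range n, φ (e i)| ≤ n * ‖φ‖ := by
      refine (Finset.abs_sum_le_sum_abs _ _).trans ?_
      simpa using Finset.sum_le_card_nsmul (Finset.range n) (fun i => |φ (e i)|) ‖φ‖
        fun i _ => φ.norm_coe_le_norm _
    rw [Set.mem_Icc, ← abs_le, abs_div, Nat.abs_cast]
    exact div_le_of_le_mul₀ (by positivity) (by positivity) (by rwa [mul_comm])
  -- Bounded averages along the orbit converge along a nonprincipal ultrafilter for all `φ` at once,
  -- so the limit is linear in `φ`.
  have hlim : ∀ φ, ∃ c, Tendsto (A φ) (hyperfilter ℕ) (𝓝 c) := fun φ => by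
    obtain ⟨c, -, hc⟩ := (isCompact_Icc (a := -‖φ‖) (b := ‖φ‖)).ultrafilter_le_nhds'
      ((hyperfilter ℕ).map (A φ)) (mem_map.2 (univ_mem' (hA φ)))
    exact ⟨c, hc⟩
  choose g hg using hlim
  have hle : (hyperfilter ℕ : Filter ℕ) ≤ atTop := by
    rw [← Nat.cofinite_eq_atTop]; exact hyperfilter_le_cofinite
  let G : C(T.graph, ℝ) →ₗ[ℝ] ℝ :=
    { toFun := g
      map_add' := fun φ ψ => tendsto_nhds_unique (hg (φ + ψ)) (((hg φ).add (hg ψ)).congr fun n => by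
        simp [A, Finset.sum_add_distrib, add_div])
      map_smul' := fun c φ => tendsto_nhds_unique (hg (c • φ))
        (((hg φ).const_mul c).congr fun n => by
          simp [A, ← Finset.mul_sum, mul_div_assoc]) }
  obtain ⟨Q, μ, h1, h2, h3, h4, -⟩ := T.exists_kernel_of_functional G
    (fun f hf => ge_of_tendsto' (hg f) fun n =>
      div_nonneg (Finset.sum_nonneg fun i _ => hf _) n.cast_nonneg)
    (tendsto_nhds_unique (hg 1) (tendsto_const_nhds.congr' (hle <| by
      filter_upwards [eventually_gt_atTop 0] with n hn
      have : (n : ℝ) ≠ 0 := by positivity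
      simp [A, this])))
    (fun u => tendsto_nhds_unique (hg (T.coboundary u)) (Tendsto.mono_left
      (squeeze_zero_norm (a := fun n : ℕ => 2 * ‖u‖ / n) (fun n => by
        have h : ∑ i ∈ Finset.range n, T.coboundary u (e i) = u (x n) - u (x 0) :=
          Finset.sum_range_sub (fun i => u (x i)) n
        simp only [A, h, norm_div, Real.norm_natCast]
        gcongr
        refine (norm_sub_le _ _).trans ?_
        linarith [u.norm_coe_le_norm (x n), u.norm_coe_le_norm (x 0)])
        (tendsto_const_div_atTop_nhds_zero_nat _)) hle))
  exact ⟨Q, μ, h1, h2, h3, h4⟩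

end Correspondence

/-! ### Marginals of the stationary Markov chain -/

section MarkovChain

variable {X : Type*} [MeasurableSpace X] {Q : Kernel X X} [IsMarkovKernel Q] {μ : Measure X}
  [IsProbabilityMeasure μ]

theorem bind_pathKernel_zero_map {X : Type*} [MeasurableSpace X] (Q : Kernel X X)
    (μ : Measure X) (i : Fin 1) : (μ.bind (pathKernel Q 0)).map (fun x => x i) = μ := by
  rw [pathKernel, Measure.deterministic_comp_eq_map, Measure.map_map (by fun_prop) (by fun_prop)]
  exact Measure.map_id

theorem bind_pathKernel_succ (n : ℕ) :
    μ.bind (pathKernel Q (n + 1)) =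
      (μ.bind (pathKernel Q n) ⊗ₘ Q.comap (fun z => z (Fin.last n)) (by fun_prop)).map
        fun p => Fin.snoc p.1 p.2 := by
  ext A hA
  rw [Measure.bind_apply hA (Kernel.aemeasurable _), Measure.map_apply (measurable_finSnoc n) hA,
    Measure.compProd_apply (measurable_finSnoc n hA), Measure.lintegral_bind (Kernel.aemeasurable _)
      (Kernel.measurable_kernel_prodMk_left (measurable_finSnoc n hA)).aemeasurable]
  exact lintegral_congr fun x => pathKernel_succ_apply Q n x hA

/-- Since `Q` is Markov, forgetting the last position recovers the shorter chain; the inductions on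
marginals use this for all positions but the last. -/
theorem bind_pathKernel_succ_map_fst (n : ℕ) {α : Type*} [MeasurableSpace α]
    {f : (Fin (n + 2) → X) → α} {g : (Fin (n + 1) → X) → α} (hf : Measurable f)
    (hg : Measurable g) (hfg : ∀ x y, f (Fin.snoc x y) = g x) :
    (μ.bind (pathKernel Q (n + 1))).map f = (μ.bind (pathKernel Q n)).map g := by
  rw [bind_pathKernel_succ, Measure.map_map hf (measurable_finSnoc n)]
  conv_rhs => rw [← Measure.fst_compProd (μ.bind (pathKernel Q n))
    (Q.comap (fun z => z (Fin.last n)) (by fun_prop)), Measure.fst,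
    Measure.map_map hg measurable_fst]
  congr 1
  ext p
  exact hfg p.1 p.2

/-- The law of the last step of the chain. -/
theorem bind_pathKernel_succ_map_last_pair (n : ℕ) :
    (μ.bind (pathKernel Q (n + 1))).map
      (fun x => (x (Fin.last n).castSucc, x (Fin.last (n + 1)))) =
      (μ.bind (pathKernel Q n)).map (fun x => x (Fin.last n)) ⊗ₘ Q := by
  rw [bind_pathKernel_succ, Measure.map_map (by fun_prop) (measurable_finSnoc n)]
  have : (fun x : Fin (n + 2) → X => (x (Fin.last n).castSucc, x (Fin.last (n + 1)))) ∘
      (fun p : (Fin (n + 1) → X) × X => (Fin.snoc p.1 p.2 : Fin (n + 2) → X)) =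
      fun p => (p.1 (Fin.last n), p.2) := by
    ext p <;> simp
  rw [this]
  have hm : Measurable fun p : (Fin (n + 1) → X) × X => (p.1 (Fin.last n), p.2) := by fun_prop
  ext A hA
  rw [Measure.map_apply hm hA, Measure.compProd_apply (hm hA), Measure.compProd_apply hA,
    lintegral_map (Kernel.measurable_kernel_prodMk_left hA) (by fun_prop)]
  rfl

theorem ProbabilityTheory.Kernel.Invariant.pathKernel_map_eval (hμ : Q.Invariant μ) (n : ℕ) (i : Fin (n + 1)) :
    (μ.bind (pathKernel Q n)).map (fun x => x i) = μ := by
  induction n with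
  | zero => exact bind_pathKernel_zero_map Q μ i
  | succ n ih =>
    refine Fin.lastCases ?_ (fun j => ?_) i
    · have h := congrArg Measure.snd (bind_pathKernel_succ_map_last_pair (Q := Q) (μ := μ) n)
      rw [ih, Measure.snd_compProd, hμ.def, Measure.snd, Measure.map_map (by fun_prop)
        (by fun_prop)] at h
      exact h
    · rw [bind_pathKernel_succ_map_fst n (g := fun x => x j) (by fun_prop) (by fun_prop)
        (by simp), ih]

theorem ProbabilityTheory.Kernel.Invariant.pathKernel_map_pair (hμ : Q.Invariant μ) (n : ℕ) (i : Fin n) :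
    (μ.bind (pathKernel Q n)).map (fun x => (x i.castSucc, x i.succ)) = μ ⊗ₘ Q := by
  induction n with
  | zero => exact i.elim0
  | succ n ih =>
    refine Fin.lastCases ?_ (fun j => ?_) i
    · have h := bind_pathKernel_succ_map_last_pair (Q := Q) (μ := μ) n
      rw [hμ.pathKernel_map_eval] at h
      exact h
    · rw [bind_pathKernel_succ_map_fst n (g := fun x => (x j.castSucc, x j.succ)) (by fun_prop)
        (by fun_prop) fun x y => ?_, ih]
      rw [Fin.succ_castSucc, Fin.snoc_castSucc, Fin.snoc_castSucc]

end MarkovChain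

/-! ### Gibbs' inequality and separated nets -/

/-- Gibbs' inequality: the entropy of a partition is at most `-∫ G` when `exp G` is bounded on
the members of the partition by the weights of a subprobability vector. -/
theorem sum_negMulLog_le_neg_integral {Ω β : Type*} [MeasurableSpace Ω] [Fintype β]
    {ν : Measure Ω} [IsProbabilityMeasure ν] {B : β → Set Ω} (hB : ∀ b, MeasurableSet (B b))
    (hdisj : Pairwise fun b c => Disjoint (B b) (B c)) (hcover : ⋃ b, B b = Set.univ)
    {q : β → ℝ} (hq0 : ∀ b, 0 ≤ q b) (hq : ∑ b, q b ≤ 1) {G : Ω → ℝ} (hG : Integrable G ν)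
    (h : ∀ᵐ x ∂ν, ∀ b, x ∈ B b → Real.exp (G x) ≤ q b) :
    ∑ b, Real.negMulLog (ν.real (B b)) ≤ -∫ x, G x ∂ν := by
  have hint : ∫ x, G x ∂ν = ∑ b, ∫ x in B b, G x ∂ν := by
    rw [← setIntegral_univ, ← hcover, integral_iUnion_fintype hB hdisj fun b => hG.integrableOn]
  have hone : ∑ b, ν.real (B b) = 1 := by
    have := measureReal_iUnion_fintype (μ := ν) hdisj hB
    rw [← this, hcover, probReal_univ]
  -- On a cell of positive measure this is `log t ≤ t - 1` at `t = q b / ν (B b)`; a null cell needs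
  -- only `0 ≤ q b`. Summation leaves `∑ q - 1 ≤ 0`.
  have key : ∀ b, Real.negMulLog (ν.real (B b)) + ∫ x in B b, G x ∂ν ≤ q b - ν.real (B b) := by
    intro b
    rcases eq_or_ne (ν (B b)) 0 with h0 | h0
    · simp [Measure.real, h0, Measure.restrict_eq_zero.2 h0, hq0 b]
    have hp : 0 < ν.real (B b) := ENNReal.toReal_pos h0 (measure_ne_top _ _)
    have hae : ∀ᵐ x ∂(ν.restrict (B b)), Real.exp (G x) ≤ q b := by
      filter_upwards [ae_restrict_of_ae h, ae_restrict_mem (hB b)] with x hx hxb using hx b hxb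
    have hqpos : 0 < q b := by
      have : (ae (ν.restrict (B b))).NeBot := by
        rwa [ae_neBot, Ne, Measure.restrict_eq_zero]
      obtain ⟨x, hx⟩ := hae.exists
      exact (Real.exp_pos _).trans_le hx
    have h1 : ∫ x in B b, G x ∂ν ≤ ν.real (B b) * Real.log (q b) := by
      calc ∫ x in B b, G x ∂ν ≤ ∫ _ in B b, Real.log (q b) ∂ν :=
            integral_mono_ae hG.integrableOn (integrable_const _) <| by
              filter_upwards [hae] with x hx using (Real.le_log_iff_exp_le hqpos).2 hx
        _ = _ := by simp
    have h2 := mul_le_mul_of_nonneg_left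
      (Real.log_le_sub_one_of_pos (div_pos hqpos hp)) hp.le
    rw [Real.log_div hqpos.ne' hp.ne', mul_sub, mul_sub, mul_div_cancel₀ _ hp.ne'] at h2
    rw [Real.negMulLog]
    linarith
  have := Finset.sum_le_sum fun b (_ : b ∈ Finset.univ) => key b
  rw [Finset.sum_add_distrib, Finset.sum_sub_distrib, ← hint, hone] at this
  linarith

/-- A compact metric space has a finite `ε`-separated set that is an `ε`-net. -/
theorem exists_separated_net (Y : Type*) [MetricSpace Y] [CompactSpace Y] {ε : ℝ} (hε : 0 < ε) :
    ∃ E : Finset Y, (E : Set Y).Pairwise (fun x y => ε ≤ dist x y) ∧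
      ∀ x, ∃ z ∈ E, dist x z ≤ ε := by
  -- A finite `ε / 2`-cover bounds the size of sets whose distinct points are more than `ε` apart,
  -- so one of largest size exists, and maximality makes it an `ε`-net.
  let δ : NNReal := (ε / 2).toNNReal
  have hδ : δ ≠ 0 := (Real.toNNReal_pos.2 (half_pos hε)).ne'
  have hεδ : ((2 * δ : NNReal) : ℝ) = ε := by
    rw [NNReal.coe_mul, Real.coe_toNNReal _ (half_pos hε).le, NNReal.coe_ofNat]; ring
  obtain ⟨C, -, hCfin, hC⟩ := Metric.exists_finite_isCover_of_isCompact hδ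
    (isCompact_univ (X := Y))
  have hfin : Metric.packingNumber (2 * δ) (Set.univ : Set Y) ≠ ⊤ :=
    ((Metric.packingNumber_two_mul_le_externalCoveringNumber δ _).trans
      hC.externalCoveringNumber_le_encard).trans_lt hCfin.encard_lt_top |>.ne
  have hEfin : (Metric.maximalSeparatedSet (2 * δ) (Set.univ : Set Y)).Finite := by
    rw [← Set.encard_ne_top_iff, Metric.encard_maximalSeparatedSet hfin]
    exact hfin
  refine ⟨hEfin.toFinset, ?_, fun x => ?_⟩
  · rw [hEfin.coe_toFinset]
    refine Metric.isSeparated_maximalSeparatedSet.mono' fun x y hxy => ?_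
    rw [edist_nndist, ENNReal.coe_lt_coe, ← NNReal.coe_lt_coe, hεδ] at hxy
    exact hxy.le
  · obtain ⟨z, hz, hxz⟩ := Metric.isCover_maximalSeparatedSet hfin (Set.mem_univ x)
    refine ⟨z, hEfin.mem_toFinset.2 hz, ?_⟩
    have : edist x z ≤ (2 * δ : NNReal) := hxz
    rw [edist_nndist, ENNReal.coe_le_coe, ← NNReal.coe_le_coe, hεδ] at this
    exact this

theorem kernelEntropy_nonneg {X : Type*} [MeasurableSpace X] (Q : Kernel X X) [IsMarkovKernel Q] (μ : Measure X)
    [IsProbabilityMeasure μ] : 0 ≤ kernelEntropy Q μ := by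
  -- Every partition has nonnegative entropy; the one-cell partition only witnesses that the
  -- supremum is not over an empty family.
  let A : FinMeasPartition X :=
    { card := 1
      part := fun _ => Set.univ
      measurableSet_part := fun _ => .univ
      disjoint_part := fun i j hij => absurd (Subsingleton.elim i j) hij
      iUnion_part := Set.iUnion_const _ }
  refine le_trans ?_ (le_iSup (kernelEntropyPartition Q μ) A)
  refine le_limsup_of_frequently_le (Frequently.of_forall fun n => ?_) (by isBoundedDefault)
  refine EReal.coe_nonneg.2 (div_nonneg (Finset.sum_nonneg fun s _ => ?_) (by positivity))
  exact Real.negMulLog_nonneg measureReal_nonneg measureReal_le_one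

/-! ### Measure-theoretic entropy is at most pressure minus the integral -/

namespace Correspondence

variable {X : Type*} [MetricSpace X] [MeasurableSpace X] [BorelSpace X] [CompactSpace X]
  {T : Correspondence X} {Q : Kernel X X} {μ : Measure X} [IsMarkovKernel Q]
  [IsProbabilityMeasure μ]

theorem Supports.ae_mem_orbits (hQ : T.Supports Q) (hμ : Q.Invariant μ) (n : ℕ) :
    ∀ᵐ x ∂(μ.bind (pathKernel Q n)), x ∈ T.orbits n := by
  refine ae_all_iff.2 fun i => ?_
  have h := hQ.ae_mem_graph (μ := μ)
  rw [← hμ.pathKernel_map_pair n i] at h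
  exact ae_of_ae_map (by fun_prop) h

/-- Each net orbit `z` carries Gibbs weight `exp (Sₙφ z) / Z` and predicts the itinerary of nearby
orbits by a product of subprobability vectors. Disjointness of the thickenings makes the prediction
unambiguous at coordinates in some `B j`; elsewhere the floor `δ` costs `-log δ`, which `hμB` makes
cheap on average. No multiplicity of cells per ball appears, so no passage to iterates is needed. -/
theorem productEntropy_le (hQ : T.Supports Q) (hμ : Q.Invariant μ) (A : FinMeasPartition X)
    (φ : C(T.graph, ℝ)) (n : ℕ) {ε η δ : ℝ} {B : Fin A.card → Set X}
    (hBmeas : ∀ j, MeasurableSet (B j)) (hBA : ∀ j, B j ⊆ A.part j)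
    (hdisj : Pairwise fun i j => Disjoint (Metric.cthickening ε (B i)) (Metric.cthickening ε (B j)))
    (hφ : ∀ p q, dist p q ≤ ε → φ p ≤ φ q + η) (hδ : 0 < δ)
    (hkδ : A.card * δ < 1) (hlog : -Real.log (1 - A.card * δ) ≤ η)
    (hμB : μ.real (⋃ j, B j)ᶜ * -Real.log δ ≤ η) {E : Finset (T.orbits n)} (hE : E.Nonempty)
    (hnet : ∀ x, ∃ z ∈ E, dist x z ≤ ε) :
    productEntropy (μ.bind (pathKernel Q n)) A ≤
      Real.log (∑ z ∈ E, Real.exp (T.birkhoff φ n z)) - n * T.doubleIntegral Q μ φ + n * η +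
        (n + 1) * (2 * η) := by
  classical
  set ν := μ.bind (pathKernel Q n) with hν
  set Z := ∑ z ∈ E, Real.exp (T.birkhoff φ n z) with hZdef
  have hZ : 0 < Z := Finset.sum_pos (fun _ _ => Real.exp_pos _) hE
  set c := 1 - A.card * δ with hc
  have hc0 : 0 < c := by linarith
  have hc1 : c ≤ 1 := by rw [hc]; linarith [mul_nonneg A.card.cast_nonneg hδ.le]
  let f : X × X → ℝ := Function.extend Subtype.val φ 0
  let N : Set X := (⋃ j, B j)ᶜ
  have hN : MeasurableSet N := (MeasurableSet.iUnion hBmeas).compl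
  -- A lower bound for the log-weight that a point within `ε` of `x` gives to the cell of `x`; its
  -- mean is at least `-2η`.
  let L : X → ℝ := fun x => Real.log c + N.indicator (fun _ => Real.log δ) x
  let ρ : X → Fin A.card → ℝ := fun w j =>
    (if w ∈ Metric.cthickening ε (B j) then c else 0) + δ
  have hρ0 : ∀ w j, 0 ≤ ρ w j := fun w j => by
    simp only [ρ]; split_ifs <;> positivity
  have hρ1 : ∀ w, ∑ j, ρ w j ≤ 1 := fun w => by
    have h1 : ∑ j, (if w ∈ Metric.cthickening ε (B j) then c else 0) ≤ c := by
      by_cases hw : ∃ j, w ∈ Metric.cthickening ε (B j)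
      · obtain ⟨j, hj⟩ := hw
        rw [Finset.sum_eq_single j, if_pos hj]
        · intro i _ hij
          rw [if_neg fun hi => Set.disjoint_left.1 (hdisj hij) hi hj]
        · simp
      · push Not at hw
        simp [hw, hc0.le]
    simp only [ρ, Finset.sum_add_distrib, Finset.sum_const, Finset.card_univ, Fintype.card_fin,
      nsmul_eq_mul]
    linarith
  have hLρ : ∀ x w j, x ∈ A.part j → dist x w ≤ ε → Real.exp (L x) ≤ ρ w j := by
    intro x w j hxj hxw
    simp only [L, Real.exp_add, Real.exp_log hc0]
    by_cases hx : x ∈ N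
    · rw [Set.indicator_of_mem hx, Real.exp_log hδ]
      refine (mul_le_of_le_one_left hδ.le hc1).trans ?_
      simp only [ρ]
      split_ifs <;> linarith
    · rw [Set.indicator_of_notMem hx, Real.exp_zero, mul_one]
      obtain ⟨i, hi⟩ := Set.mem_iUnion.1 (not_not.1 hx)
      have hij : i = j := by
        by_contra hne
        exact Set.disjoint_left.1 (A.disjoint_part hne) (hBA i hi) hxj
      subst hij
      have : w ∈ Metric.cthickening ε (B i) :=
        Metric.mem_cthickening_of_dist_le w x ε _ hi (by rwa [dist_comm])
      simp only [ρ, if_pos this]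
      linarith
  -- The mixture over the net of the product weights; its total mass is at most one.
  let q : (Fin (n + 1) → Fin A.card) → ℝ := fun s =>
    ∑ z ∈ E, Real.exp (T.birkhoff φ n z) / Z * ∏ i, ρ (z.1 i) (s i)
  have hterm : ∀ (z : T.orbits n) (s : Fin (n + 1) → Fin A.card), 0 ≤ Real.exp (T.birkhoff φ n z) / Z * ∏ i, ρ (z.1 i) (s i) := fun z s =>
    mul_nonneg (by positivity) (Finset.prod_nonneg fun i _ => hρ0 _ _)
  -- The term `n * η` pays for replacing the Birkhoff sum at `x` by that at the nearby net point.
  let G : (Fin (n + 1) → X) → ℝ := fun x =>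
    ∑ i : Fin n, f (x i.castSucc, x i.succ) + ∑ i, L (x i) - (n * η + Real.log Z)
  have hLint : ∀ m : Measure X, IsProbabilityMeasure m → Integrable L m := fun m _ =>
    (integrable_const _).add ((integrable_const _).indicator hN)
  have hfint : Integrable f (μ ⊗ₘ Q) := integrable_extend φ _
  have hf_i : ∀ i : Fin n, Integrable (fun x => f (x i.castSucc, x i.succ)) ν := fun i =>
    Integrable.comp_measurable (μ := ν) (g := f)
      (f := fun x : Fin (n + 1) → X => (x i.castSucc, x i.succ))
      (by rw [hν, hμ.pathKernel_map_pair]; exact hfint) (by fun_prop)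
  have hL_i : ∀ i, Integrable (fun x => L (x i)) ν := fun i =>
    Integrable.comp_measurable (μ := ν) (g := L) (f := fun x : Fin (n + 1) → X => x i)
      (by rw [hν, hμ.pathKernel_map_eval]; exact hLint μ inferInstance) (by fun_prop)
  have hf_int : ∀ i : Fin n, ∫ x, f (x i.castSucc, x i.succ) ∂ν = T.doubleIntegral Q μ φ := by
    intro i
    rw [hQ.doubleIntegral_eq_integral_extend, ← hμ.pathKernel_map_pair n i,
      integral_map (by fun_prop) (measurable_extend φ).aestronglyMeasurable]
  have hL_int : ∀ i, -(2 * η) ≤ ∫ x, L (x i) ∂ν := by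
    intro i
    have : ∫ x, L (x i) ∂ν = ∫ x, L x ∂μ := by
      conv_rhs => rw [← hμ.pathKernel_map_eval n i]
      refine (integral_map (measurable_pi_apply i).aemeasurable ?_).symm
      rw [hμ.pathKernel_map_eval]
      exact (hLint μ inferInstance).aestronglyMeasurable
    rw [this, integral_add (integrable_const _) ((integrable_const _).indicator hN),
      integral_indicator_const _ hN]
    simp only [integral_const, probReal_univ, smul_eq_mul, one_mul]
    linarith
  have hGint : Integrable G ν :=
    ((integrable_finsetSum _ fun i _ => hf_i i).add (integrable_finsetSum _ fun i _ => hL_i i)).sub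
      (integrable_const _)
  have hGval : ∫ x, G x ∂ν = n * T.doubleIntegral Q μ φ + ∑ i, ∫ x, L (x i) ∂ν -
      (n * η + Real.log Z) := by
    have h1 := integrable_finsetSum Finset.univ fun i _ => hf_i i
    have h2 := integrable_finsetSum Finset.univ fun i _ => hL_i i
    rw [integral_sub (f := fun x : Fin (n + 1) → X => ∑ i : Fin n, f (x i.castSucc, x i.succ) +
      ∑ i, L (x i)) (h1.add h2) (integrable_const _), integral_add h1 h2, integral_finsetSum _ fun i _ => hf_i i, integral_finsetSum _ fun i _ => hL_i i]
    simp [hf_int]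
  have hmain : productEntropy ν A ≤ -∫ x, G x ∂ν := by
    refine sum_negMulLog_le_neg_integral (q := q)
      (fun s => MeasurableSet.univ_pi fun i => A.measurableSet_part _) ?_ ?_
      (fun s => Finset.sum_nonneg fun z _ => hterm z s) ?_ hGint ?_
    · intro s t hst
      obtain ⟨i, hi⟩ := Function.ne_iff.1 hst
      exact Set.disjoint_left.2 fun x hxs hxt => Set.disjoint_left.1 (A.disjoint_part hi)
        (hxs i trivial) (hxt i trivial)
    · refine Set.eq_univ_of_forall fun x => ?_
      have : ∀ i, ∃ j, x i ∈ A.part j := fun i => by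
        rw [← Set.mem_iUnion, A.iUnion_part]; trivial
      choose s hs using this
      exact Set.mem_iUnion.2 ⟨s, fun i _ => hs i⟩
    · calc ∑ s, q s = ∑ z ∈ E, Real.exp (T.birkhoff φ n z) / Z *
            ∏ i : Fin (n + 1), ∑ j, ρ (z.1 i) j := by
            simp only [q]
            rw [Finset.sum_comm]
            refine Finset.sum_congr rfl fun z _ => ?_
            rw [← Finset.mul_sum, Finset.prod_univ_sum, Fintype.piFinset_univ]
        _ ≤ ∑ z ∈ E, Real.exp (T.birkhoff φ n z) / Z * 1 := by
            gcongr with z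
            exact Finset.prod_le_one (fun i _ => Finset.sum_nonneg fun j _ => hρ0 _ _)
              fun i _ => hρ1 _
        _ = 1 := by simp only [mul_one]; rw [← Finset.sum_div, div_self hZ.ne']
    · filter_upwards [hQ.ae_mem_orbits hμ n] with x hx s hs
      obtain ⟨z, hzE, hxz⟩ := hnet ⟨x, hx⟩
      have hxz' : ∀ i, dist (x i) (z.1 i) ≤ ε := fun i => (dist_le_pi_dist x z.1 i).trans hxz
      refine le_trans ?_ (Finset.single_le_sum (fun z _ => hterm z s) hzE)
      have h1 : ∑ i : Fin n, f (x i.castSucc, x i.succ) ≤ T.birkhoff φ n z + n * η := by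
        calc ∑ i : Fin n, f (x i.castSucc, x i.succ)
            ≤ ∑ i : Fin n, (φ ⟨(z.1 i.castSucc, z.1 i.succ), z.2 i⟩ + η) := by
              refine Finset.sum_le_sum fun i _ => ?_
              have : f (x i.castSucc, x i.succ) = φ ⟨(x i.castSucc, x i.succ), hx i⟩ :=
                Subtype.val_injective.extend_apply φ 0 ⟨(x i.castSucc, x i.succ), hx i⟩
              rw [this]
              exact hφ _ _ (max_le (hxz' _) (hxz' _))
          _ = _ := by simp [Finset.sum_add_distrib, birkhoff]
      calc Real.exp (G x) ≤ Real.exp (T.birkhoff φ n z - Real.log Z + ∑ i, L (x i)) :=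
            Real.exp_le_exp.2 (by simp only [G]; linarith)
        _ = Real.exp (T.birkhoff φ n z) / Z * ∏ i, Real.exp (L (x i)) := by
            rw [Real.exp_add, Real.exp_sub, Real.exp_log hZ, Real.exp_sum]
        _ ≤ _ := by
            gcongr with i
            exact hLρ _ _ _ (hs i trivial) (hxz' i)
  have hsum : ∑ _ : Fin (n + 1), -(2 * η) ≤ ∑ i, ∫ x, L (x i) ∂ν :=
    Finset.sum_le_sum fun i _ => hL_int i
  simp only [Finset.sum_const, Finset.card_univ, Fintype.card_fin, nsmul_eq_mul, Nat.cast_add,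
    Nat.cast_one] at hsum
  rw [hGval] at hmain
  linarith

/-- A finite measurable partition has a compact refinement up to small measure. -/
theorem exists_compact_subpartition (μ : Measure X) [IsProbabilityMeasure μ]
    (A : FinMeasPartition X) {θ : ℝ} (hθ : 0 < θ) :
    ∃ B : Fin A.card → Set X, (∀ j, IsCompact (B j)) ∧ (∀ j, B j ⊆ A.part j) ∧
      μ.real (⋃ j, B j)ᶜ ≤ θ := by
  -- The `+ 1` keeps the denominator nonzero without a separate argument that the partition has a
  -- member.
  have h : ∀ j, ∃ K ⊆ A.part j, IsCompact K ∧
      μ (A.part j \ K) < ENNReal.ofReal (θ / (A.card + 1)) := fun j =>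
    (A.measurableSet_part j).exists_isCompact_sdiff_lt (measure_ne_top _ _)
      (by rw [Ne, ENNReal.ofReal_eq_zero, not_le]; positivity)
  choose B hBA hBc hBμ using h
  refine ⟨B, hBc, hBA, ?_⟩
  have hsub : (⋃ j, B j)ᶜ ⊆ ⋃ j, A.part j \ B j := fun x hx => by
    obtain ⟨j, hj⟩ := Set.mem_iUnion.1 (A.iUnion_part ▸ Set.mem_univ x)
    exact Set.mem_iUnion.2 ⟨j, hj, fun hB => hx (Set.mem_iUnion.2 ⟨j, hB⟩)⟩
  calc μ.real (⋃ j, B j)ᶜ ≤ μ.real (⋃ j, A.part j \ B j) := measureReal_mono hsub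
    _ ≤ ∑ j, μ.real (A.part j \ B j) := measureReal_iUnion_fintype_le _
    _ ≤ ∑ _ : Fin A.card, θ / (A.card + 1) := Finset.sum_le_sum fun j _ =>
        ENNReal.toReal_le_of_le_ofReal (by positivity) (hBμ j).le
    _ ≤ θ := by
        simp only [Finset.sum_const, Finset.card_univ, Fintype.card_fin, nsmul_eq_mul]
        rw [mul_div_assoc', div_le_iff₀ (by positivity)]
        nlinarith

/-- The choices are made in the order `δ`, then the compact sets (whose missing mass must beat `-log
δ`), then `ε` (which must separate them and control the oscillation of `φ`). -/
theorem kernelEntropyPartition_le [Nonempty X] (hQ : T.Supports Q) (hμ : Q.Invariant μ)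
    (A : FinMeasPartition X) (φ : C(T.graph, ℝ)) {a : ℝ} (ha : T.pressure φ < a) :
    kernelEntropyPartition Q μ A ≤ ((a - T.doubleIntegral Q μ φ : ℝ) : EReal) := by
  obtain ⟨b, hb, hba⟩ := EReal.lt_iff_exists_real_btwn.1 ha
  replace hba : b < a := by exact_mod_cast hba
  -- One `η` is for the oscillation of `φ` and four are for `(n + 1) * (2 * η) ≤ n * (4 * η)`.
  set η := (a - b) / 5 with hηdef
  have hη : 0 < η := by rw [hηdef]; linarith
  obtain ⟨δ, hδ, hδ1, hkδ, hlog⟩ : ∃ δ : ℝ, 0 < δ ∧ δ ≤ 1 ∧ A.card * δ < 1 ∧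
      -Real.log (1 - A.card * δ) ≤ η := by
    have h1 : Tendsto (fun δ : ℝ => A.card * δ) (𝓝[>] 0) (𝓝 0) := by
      have : Continuous fun δ : ℝ => A.card * δ := by fun_prop
      simpa using (this.tendsto 0).mono_left nhdsWithin_le_nhds
    have h2 : Tendsto (fun δ : ℝ => -Real.log (1 - A.card * δ)) (𝓝[>] 0) (𝓝 0) := by
      simpa using ((h1.const_sub 1).log (by norm_num)).neg
    obtain ⟨δ, h3, h4, h5⟩ := ((h1.eventually_lt_const one_pos).and
      ((h2.eventually_le_const hη).and (Ioc_mem_nhdsGT one_pos))).exists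
    exact ⟨δ, h5.1, h5.2, h3, h4⟩
  obtain ⟨B, hBc, hBA, hBμ⟩ := exists_compact_subpartition μ A
    (θ := η / (-Real.log δ + 1)) (div_pos hη (by linarith [Real.log_nonpos hδ.le hδ1]))
  have hμB : μ.real (⋃ j, B j)ᶜ * -Real.log δ ≤ η := by
    have h0 := Real.log_nonpos hδ.le hδ1
    have h1 : 0 < -Real.log δ + 1 := by linarith
    calc _ ≤ η / (-Real.log δ + 1) * (-Real.log δ + 1) := by gcongr <;> first | positivity | linarith
      _ = η := div_mul_cancel₀ _ (by linarith)
  obtain ⟨ε, hε, hdisj, hφ⟩ : ∃ ε : ℝ, 0 < ε ∧ (∀ i j, i ≠ j →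
      Disjoint (Metric.cthickening ε (B i)) (Metric.cthickening ε (B j))) ∧
      ∀ p q, dist p q ≤ ε → φ p ≤ φ q + η := by
    have h1 : ∀ᶠ ε : ℝ in 𝓝[>] 0, ∀ i j, i ≠ j →
        Disjoint (Metric.cthickening ε (B i)) (Metric.cthickening ε (B j)) := by
      refine eventually_all.2 fun i => eventually_all.2 fun j => ?_
      by_cases hij : i = j
      · exact .of_forall fun _ h => absurd hij h
      obtain ⟨r, hr, hd⟩ := ((A.disjoint_part hij).mono (hBA i) (hBA j)).exists_cthickenings
        (hBc i) (hBc j).isClosed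
      filter_upwards [Ioc_mem_nhdsGT hr] with ε hε _
      exact hd.mono (Metric.cthickening_mono hε.2 _) (Metric.cthickening_mono hε.2 _)
    have h2 : ∀ᶠ ε : ℝ in 𝓝[>] 0, ∀ p q, dist p q ≤ ε → φ p ≤ φ q + η := by
      obtain ⟨r, hr, hd⟩ := Metric.uniformContinuous_iff.1
        (CompactSpace.uniformContinuous_of_continuous φ.continuous) η hη
      filter_upwards [Ioo_mem_nhdsGT hr] with ε hε p q hpq
      have := hd (hpq.trans_lt hε.2)
      rw [Real.dist_eq] at this
      linarith [(abs_lt.1 this).2]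
    obtain ⟨ε, h, h', h''⟩ := (h1.and (h2.and self_mem_nhdsWithin)).exists
    exact ⟨ε, h'', h, h'⟩
  refine limsup_le_of_le (by isBoundedDefault) ?_
  filter_upwards [eventually_sum_le_of_pressureAt_lt ((pressureAt_le_pressure hε).trans_lt hb),
    eventually_gt_atTop 0] with n hn hn0
  rw [EReal.coe_le_coe_iff]
  obtain ⟨E, hEsep, hnet⟩ := exists_separated_net (T.orbits n) hε
  have hEne : E.Nonempty := by
    obtain ⟨z, hz, -⟩ := hnet (Classical.arbitrary _)
    exact ⟨z, hz⟩
  have h1 := productEntropy_le hQ hμ A φ n (fun j => (hBc j).measurableSet) hBA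
    (fun i j => hdisj i j) hφ hδ hkδ hlog hμB hEne hnet
  have h2 : Real.log (∑ z ∈ E, Real.exp (T.birkhoff φ n z)) ≤ n * b := by
    rw [Real.log_le_iff_le_exp (Finset.sum_pos (fun _ _ => Real.exp_pos _) hEne)]
    exact hn E hEsep
  have h0 : 0 ≤ productEntropy (μ.bind (pathKernel Q n)) A :=
    Finset.sum_nonneg fun s _ => Real.negMulLog_nonneg measureReal_nonneg measureReal_le_one
  have hn1 : (1 : ℝ) ≤ n := by exact_mod_cast hn0
  -- The entropy is nonnegative, so dividing by `n` in place of `n + 1` only increases the quotient.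
  calc productEntropy (μ.bind (pathKernel Q n)) A / ((n : ℝ) + 1)
      ≤ productEntropy (μ.bind (pathKernel Q n)) A / n := by gcongr; linarith
    _ ≤ a - T.doubleIntegral Q μ φ := by
        rw [div_le_iff₀ (by positivity)]
        have : a = b + 5 * η := by rw [hηdef]; ring
        rw [this]
        nlinarith

/-- The easy half of the variational principle. -/
theorem kernelEntropy_le_pressure_sub [Nonempty X] (hQ : T.Supports Q) (hμ : Q.Invariant μ)
    (φ : C(T.graph, ℝ)) :
    kernelEntropy Q μ ≤ T.pressure φ - (T.doubleIntegral Q μ φ : EReal) := by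
  refine iSup_le fun A => ?_
  rw [EReal.le_sub_iff_add_le (by simp) (by simp)]
  refine EReal.le_of_forall_lt_iff_le.1 fun a ha => ?_
  rw [← EReal.le_sub_iff_add_le (by simp) (by simp), ← EReal.coe_sub]
  exact kernelEntropyPartition_le hQ hμ A φ ha

end Correspondence

/-! ### Legendre duality and the variational principle -/

namespace Correspondence

theorem convexOn_toReal_pressure {X : Type*} [MetricSpace X] [CompactSpace X] [Nonempty X]
    {T : Correspondence X} (h : T.topEntropy < ⊤) :
    ConvexOn ℝ Set.univ fun φ => (T.pressure φ).toReal := by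
  refine ⟨convex_univ, fun φ _ ψ _ s t hs ht hst => le_of_forall_pos_le_add fun η hη => ?_⟩
  have hlt : ∀ φ : C(T.graph, ℝ), T.pressure φ < (((T.pressure φ).toReal + η : ℝ) : EReal) := by
    intro φ
    rw [← coe_toReal_pressure h φ, EReal.toReal_coe, EReal.coe_lt_coe_iff]
    linarith
  have := pressure_combo_le hs ht hst (hlt φ) (hlt ψ)
  rw [← coe_toReal_pressure h, EReal.coe_le_coe_iff] at this
  refine this.trans (le_of_eq ?_)
  simp only [smul_eq_mul]
  linear_combination η * hst

variable {X : Type*} [MetricSpace X] [CompactSpace X] [MeasurableSpace X] [BorelSpace X]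
  {T : Correspondence X}

theorem abstractEntropy_eq_iInf {Q : Kernel X X} {μ : Measure X} [IsMarkovKernel Q]
    [IsProbabilityMeasure μ] (hQ : T.Supports Q) :
    T.abstractEntropy Q μ =
      ⨅ φ : C(T.graph, ℝ), (T.pressure φ - (T.doubleIntegral Q μ φ : EReal)) := by
  refine le_antisymm (le_iInf fun φ => ?_) (le_iInf₂ fun φ hφ => ?_)
  · rw [EReal.le_sub_iff_add_le (by simp) (by simp)]
    refine EReal.le_of_forall_lt_iff_le.1 fun a ha => ?_
    rw [← EReal.le_sub_iff_add_le (by simp) (by simp)]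
    -- For real `a` above the pressure of `φ`, the function `a - φ` is admissible, since `P(T, φ -
    -- a) = P(T, φ) - a ≤ 0`.
    refine iInf₂_le_of_le (ContinuousMap.const _ a - φ) ?_ (le_of_eq ?_)
    · rw [show -(ContinuousMap.const _ a - φ) = φ + ContinuousMap.const _ (-a) by
        ext p; simp; ring, pressure_add_const]
      calc T.pressure φ + ((-a : ℝ) : EReal) ≤ (a : EReal) + ((-a : ℝ) : EReal) := by
            gcongr
        _ = 0 := by rw [← EReal.coe_add]; simp
    · rw [sub_eq_add_neg, hQ.doubleIntegral_add, hQ.doubleIntegral_neg, hQ.doubleIntegral_const,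
        ← sub_eq_add_neg, EReal.coe_sub]
  · refine iInf_le_of_le (-φ) ?_
    rw [hQ.doubleIntegral_neg, EReal.coe_neg, sub_eq_add_neg, neg_neg]
    calc _ ≤ 0 + (T.doubleIntegral Q μ φ : EReal) := by gcongr
      _ = _ := zero_add _

theorem abstractEntropy_add_le_pressure {Q : Kernel X X} {μ : Measure X} [IsMarkovKernel Q]
    [IsProbabilityMeasure μ] (hQ : T.Supports Q) (φ : C(T.graph, ℝ)) :
    T.abstractEntropy Q μ + (T.doubleIntegral Q μ φ : EReal) ≤ T.pressure φ := by
  rw [← EReal.le_sub_iff_add_le (by simp) (by simp), abstractEntropy_eq_iInf hQ]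
  exact iInf_le _ φ

/-- With infinite topological entropy the duality formula is an infimum of `⊤`, so any invariant
pair attains the maximum. Otherwise a subgradient of the finite convex pressure at `φ` does. -/
theorem exists_invariant_eq_pressure [Nonempty X] (T : Correspondence X) (φ : C(T.graph, ℝ)) :
    ∃ (Q : Kernel X X) (μ : Measure X), IsMarkovKernel Q ∧ T.Supports Q ∧
      IsProbabilityMeasure μ ∧ Q.Invariant μ ∧
      T.pressure φ = T.abstractEntropy Q μ + (T.doubleIntegral Q μ φ : EReal) := by
  rcases eq_or_ne T.topEntropy ⊤ with h | h
  · obtain ⟨Q, μ, h1, h2, h3, h4⟩ := T.exists_invariant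
    refine ⟨Q, μ, h1, h2, h3, h4, ?_⟩
    have : T.abstractEntropy Q μ = ⊤ := by
      rw [abstractEntropy_eq_iInf h2, iInf_eq_top]
      intro ψ
      rw [(pressure_eq_top_iff ψ).2 h, EReal.top_sub_coe]
    rw [this, (pressure_eq_top_iff φ).2 h, EReal.top_add_coe]
  · have h' := h.lt_top
    obtain ⟨Q, μ, h1, h2, h3, h4, h5⟩ := T.exists_kernel_subgradient
      (convexOn_toReal_pressure h')
      (fun φ ψ c hle => by
        have := pressure_le_add_of_le c hle
        rwa [← coe_toReal_pressure h', ← coe_toReal_pressure h' φ, ← EReal.coe_add,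
          EReal.coe_le_coe_iff] at this)
      (fun φ u => by rw [pressure_add_coboundary]) φ
    refine ⟨Q, μ, h1, h2, h3, h4, le_antisymm ?_ (abstractEntropy_add_le_pressure h2 φ)⟩
    rw [← EReal.sub_le_iff_le_add (by simp) (by simp), abstractEntropy_eq_iInf h2]
    refine le_iInf fun ψ => ?_
    rw [← coe_toReal_pressure h', ← coe_toReal_pressure h' ψ, ← EReal.coe_sub, ← EReal.coe_sub,
      EReal.coe_le_coe_iff]
    exact h5 ψ

theorem invariant_of_eq_pressure [Nonempty X] (h : T.topEntropy < ⊤) {Q : Kernel X X} {μ : Measure X}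
    [IsMarkovKernel Q] [IsProbabilityMeasure μ] (hQ : T.Supports Q) {φ : C(T.graph, ℝ)}
    (heq : T.abstractEntropy Q μ + (T.doubleIntegral Q μ φ : EReal) = T.pressure φ) :
    Q.Invariant μ := by
  -- The upper bound at `φ + T.coboundary u` has the same right-hand side as the equality at `φ`;
  -- finiteness allows cancellation. Applying this to `-u` as well forces equality.
  have key : ∀ u, T.doubleIntegral Q μ (T.coboundary u) ≤ 0 := fun u => by
    have h1 := abstractEntropy_add_le_pressure (μ := μ) hQ (φ + T.coboundary u)
    have h2 : T.abstractEntropy Q μ + (T.doubleIntegral Q μ φ : EReal) ≠ ⊤ := by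
      rw [heq]; exact fun h' => h.ne ((pressure_eq_top_iff φ).1 h')
    have h3 : T.abstractEntropy Q μ + (T.doubleIntegral Q μ φ : EReal) ≠ ⊥ := by
      rw [heq]; exact pressure_ne_bot φ
    rw [pressure_add_coboundary, ← heq, hQ.doubleIntegral_add, EReal.coe_add, ← add_assoc,
      ← EReal.coe_toReal h2 h3, ← EReal.coe_add, EReal.coe_le_coe_iff] at h1
    linarith
  refine hQ.invariant_of_doubleIntegral_coboundary fun u => le_antisymm (key u) ?_
  have : T.coboundary (-u) = -T.coboundary u := by ext p; simp [coboundary]; ring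
  have h1 := key (-u)
  rw [this, hQ.doubleIntegral_neg] at h1
  linarith

end Correspondence

theorem mainTheorem1 {X : Type*} [MetricSpace X] [CompactSpace X] [Nonempty X]
    [MeasurableSpace X] [BorelSpace X] (T : Correspondence X) :
    -- the variational principle, over all probability measures and over the invariant ones
    (∀ φ : C(T.graph, ℝ),
      IsGreatest {p : EReal | ∃ (Q : Kernel X X) (μ : Measure X), IsMarkovKernel Q ∧
          T.Supports Q ∧ IsProbabilityMeasure μ ∧
          p = T.abstractEntropy Q μ + (T.doubleIntegral Q μ φ : EReal)} (T.pressure φ) ∧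
      IsGreatest {p : EReal | ∃ (Q : Kernel X X) (μ : Measure X), IsMarkovKernel Q ∧
          T.Supports Q ∧ IsProbabilityMeasure μ ∧ Q.Invariant μ ∧
          p = T.abstractEntropy Q μ + (T.doubleIntegral Q μ φ : EReal)} (T.pressure φ)) ∧
    -- maximizing pairs are invariant
    (T.topEntropy < ⊤ → ∀ (φ : C(T.graph, ℝ)) (Q : Kernel X X) (μ : Measure X),
      IsMarkovKernel Q → T.Supports Q → IsProbabilityMeasure μ →
      T.abstractEntropy Q μ + (T.doubleIntegral Q μ φ : EReal) = T.pressure φ →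
      Q.Invariant μ) ∧
    -- the inverse variational principle
    (∀ (Q : Kernel X X) (μ : Measure X), IsMarkovKernel Q → T.Supports Q →
      IsProbabilityMeasure μ →
      T.abstractEntropy Q μ =
        ⨅ φ : C(T.graph, ℝ), (T.pressure φ - (T.doubleIntegral Q μ φ : EReal))) ∧
    -- comparison with the measure-theoretic entropy
    (∀ (Q : Kernel X X) (μ : Measure X), IsMarkovKernel Q → T.Supports Q →
      IsProbabilityMeasure μ → Q.Invariant μ →
      0 ≤ kernelEntropy Q μ ∧ kernelEntropy Q μ ≤ T.abstractEntropy Q μ) := by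
  refine ⟨fun φ => ?_, ?_, ?_, ?_⟩
  · obtain ⟨Q, μ, h1, h2, h3, h4, h5⟩ := T.exists_invariant_eq_pressure φ
    refine ⟨⟨⟨Q, μ, h1, h2, h3, h5⟩, ?_⟩, ⟨⟨Q, μ, h1, h2, h3, h4, h5⟩, ?_⟩⟩
    · rintro _ ⟨Q, μ, _, hQ, _, rfl⟩
      exact Correspondence.abstractEntropy_add_le_pressure hQ φ
    · rintro _ ⟨Q, μ, _, hQ, _, -, rfl⟩
      exact Correspondence.abstractEntropy_add_le_pressure hQ φ
  · intro h φ Q μ _ hQ _ heq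
    exact Correspondence.invariant_of_eq_pressure h hQ heq
  · intro Q μ _ hQ _
    exact Correspondence.abstractEntropy_eq_iInf hQ
  · intro Q μ _ hQ _ hμ
    refine ⟨kernelEntropy_nonneg Q μ, ?_⟩
    rw [Correspondence.abstractEntropy_eq_iInf hQ]
    exact le_iInf fun φ => Correspondence.kernelEntropy_le_pressure_sub hQ hμ φ
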